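/- A composition is a finite (possibly empty) list $\alpha=(\alpha_1,\dots,\alpha_\ell)$ of positive integers; put $|\alpha|=\alpha_1+\cdots+\alpha_\ell$ and $\ell(\alpha)=\ell$. For compositions with $|\beta|=|\alpha|$ write $\beta\le\alpha$ if $\{\beta_1,\beta_1+\beta_2,\dots,\beta_1+\cdots+\beta_{\ell(\beta)-1}\}\subseteq\{\alpha_1,\dots,\alpha_1+\cdots+\alpha_{\ell(\alpha)-1}\}$, so that each $\beta_i$ is a sum of consecutive parts of $\alpha$. Let $\mathrm{QSym}=\bigoplus_{n\ge0}\mathrm{QSym}_n$ be the graded Hopf algebra of quasisymmetric functions over $\mathbb C$, where $\mathrm{QSym}_n$ is spanned by the monomial quasisymmetric functions $M_\alpha=\sum_{i_1<\cdots<i_\ell}x_{i_1}^{\alpha_1}\cdots x_{i_\ell}^{\alpha_\ell}$ with $|\alpha|=n$, the product is that of power series, and the coproduct is $\Delta(M_\alpha)=\sum_{\beta\gamma=\alpha}M_\beta\otimes M_\gamma$ (sum over all ways to write $\alpha$ as a concatenation). Let $\zeta:\mathrm{QSym}\to\mathbb C$, $\zeta(f)=f(1,0,0,\dots)$, let $\zeta^{-1}=\zeta\circ\mathcal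 S$ with $\mathcal S$ the antipode, for a linear functional $\chi$ let $\overline{\chi}$ be the functional equal to $(-1)^n\chi$ on $\mathrm{QSym}_n$, and let $\overline{\zeta^{-1}}\,\zeta$ be the convolution product of $\overline{\zeta^{-1}}$ and $\zeta$. For a composition $\alpha$, let $m_o(\alpha)$ be the composition obtained by cutting $\alpha$ between $\alpha_i$ and $\alpha_{i+1}$ whenever $\alpha_i$ is odd and $\alpha_{i+1}$ is even, and replacing each resulting segment by its sum. For $m_o(\alpha)\le\beta\le\alpha$ put $c_\alpha^\beta=\prod_i\frac1{O_i!\,E_i!}$, where $O_i$ and $E_i$ are the numbers of odd and even parts among the consecutive parts of $\alpha$ that add up to $\beta_i$. The shuffle functions are $$S_\alpha=\sum_{m_o(\alpha)\le\beta\le\alpha}c_\alpha^\beta M_\beta .$$ **Theorem.** The family $(S_\alpha)_\alpha$ is linearly independent, and for every $n\ge0$ the $S_\alpha$ with $|\alpha|=n$ span $\mathrm{QSym}_n$. There is a unique graded Hopf algebra morphism $\Theta_{\mathrm{QSym}}:\mathrm{QSym}\to\mathrm{QSym}$ with $\zeta\circ\Theta_{\mathrm{QSym}}=\overline{\zeta^{-1}}\,\zeta$,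 and for every composition $\alpha$ $$\Theta_{\mathrm{QSym}}(S_\alpha)=\begin{cases}2^{\ell(\alpha)}S_\alpha&\text{if every part of }\alpha\text{ is odd},\\ 0&\text{otherwise.}\end{cases}$$ Hence the peak algebra $\Pi=\Theta_{\mathrm{QSym}}(\mathrm{QSym})$ is the linear span of the $S_\alpha$ with all parts of $\alpha$ odd. -/

import Mathlib

noncomputable section
open scoped TensorProduct

namespace QSym

/-! Compositions are lists of positive integers; the empty list is the composition of `0`, and
the length `ℓ(α)` is `α.length`. -/

/-- The size `|α| = α₁ + ⋯ + α_ℓ`. -/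
def size (α : List ℕ+) : ℕ := (α.map PNat.val).sum

/-- The nonzero exponents of a monomial, read in increasing order of the variables. -/
def expsList {σ : Type*} [LinearOrder σ] (m : σ →₀ ℕ) : List ℕ+ :=
  (m.support.sort).map (fun i => (m i).toPNat')

/-- The series, in variables indexed by `σ`, whose coefficient at a monomial is prescribed as a
function of its list of nonzero exponents. -/
def qs (σ : Type*) [LinearOrder σ] (G : List ℕ+ → ℂ) : MvPowerSeries σ ℂ :=
  fun m => G (expsList m)

theorem coeff_qs {σ : Type*} [LinearOrder σ] (G : List ℕ+ → ℂ) (m : σ →₀ ℕ) :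
    MvPowerSeries.coeff m (qs σ G) = G (expsList m) := rfl

theorem expsList_embDomain {σ τ : Type*} [LinearOrder σ] [LinearOrder τ] (f : σ ↪o τ)
    (m : σ →₀ ℕ) : expsList (m.embDomain f.toEmbedding) = expsList m := by
  unfold expsList
  rw [Finsupp.support_embDomain]
  have h := Finset.map_sort (r := (· ≤ ·)) (r' := (· ≤ ·)) f.toEmbedding m.support
    (fun a _ b _ => (f.le_iff_le (a := a) (b := b)).symm)
  rw [← h, List.map_map]
  apply List.map_congr_left
  intro a _
  simp only [Function.comp]
  rw [Finsupp.embDomain_apply_self]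

theorem exists_compress {σ : Type*} [LinearOrder σ] (m : σ →₀ ℕ) :
    ∃ f : Fin (expsList m).length ↪o σ,
      m = (Finsupp.equivFunOnFinite.symm
        (fun i => (((expsList m).get i : ℕ+) : ℕ))).embDomain f.toEmbedding := by
  have hc : m.support.card = (expsList m).length := by simp [expsList]
  refine ⟨m.support.orderEmbOfFin hc, ?_⟩
  ext x
  by_cases hx : x ∈ m.support
  · have hx' := hx
    rw [← Finset.mem_coe, ← Finset.range_orderEmbOfFin m.support hc] at hx'
    obtain ⟨i, rfl⟩ := hx'
    have := Finsupp.embDomain_apply_self (m.support.orderEmbOfFin hc).toEmbedding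
      (Finsupp.equivFunOnFinite.symm (fun i => (((expsList m).get i : ℕ+) : ℕ))) i
    rw [RelEmbedding.coe_toEmbedding] at this
    rw [this]
    have h2 : (expsList m).get i = (m (m.support.orderEmbOfFin hc i)).toPNat' := by
      rw [Finset.orderEmbOfFin_apply]
      exact List.getElem_map _
    rw [Finsupp.coe_equivFunOnFinite_symm, h2, Nat.toPNat'_coe, if_pos]
    exact Nat.pos_of_ne_zero (Finsupp.mem_support_iff.1 hx)
  · rw [Finsupp.embDomain_of_notMem_range]
    · simpa using hx
    · rw [RelEmbedding.coe_toEmbedding, Finset.range_orderEmbOfFin]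
      simpa using hx

theorem coeff_qs_mul_embDomain {σ τ : Type*} [LinearOrder σ] [LinearOrder τ] (f : σ ↪o τ)
    (G H : List ℕ+ → ℂ) (m : σ →₀ ℕ) :
    MvPowerSeries.coeff (m.embDomain f.toEmbedding) (qs τ G * qs τ H) =
      MvPowerSeries.coeff m (qs σ G * qs σ H) := by
  classical
  rw [MvPowerSeries.coeff_mul, MvPowerSeries.coeff_mul,
    ← Finsupp.image_prodMap_embDomain_antidiagonal, Finset.sum_image]
  · simp [coeff_qs, expsList_embDomain]
  · intro a _ b _ h
    have := Finsupp.embDomain_injective (M := ℕ) f.toEmbedding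
    simp only [Prod.map, Prod.mk.injEq] at h
    exact Prod.ext (this h.1) (this h.2)

/-- The coefficient function of a product of two series of the form `qs`. -/
def coeffMul (G H : List ℕ+ → ℂ) (α : List ℕ+) : ℂ :=
  MvPowerSeries.coeff (Finsupp.equivFunOnFinite.symm (fun i => ((α.get i : ℕ+) : ℕ)))
    (qs (Fin α.length) G * qs (Fin α.length) H)

theorem qs_mul (σ : Type*) [LinearOrder σ] (G H : List ℕ+ → ℂ) :
    qs σ G * qs σ H = qs σ (coeffMul G H) := by
  ext m
  obtain ⟨f, hf⟩ := exists_compress m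
  rw [coeff_qs, coeffMul, ← coeff_qs_mul_embDomain f, ← hf]

theorem sum_toPNat {σ : Type*} (l : List σ) (m : σ → ℕ) (h : ∀ i ∈ l, m i ≠ 0) :
    size (l.map (fun i => (m i).toPNat')) = (l.map m).sum := by
  induction l with
  | nil => rfl
  | cons a l ih =>
    simp only [List.map_cons, List.sum_cons, size] at *
    rw [ih (fun i hi => h i (by simp [hi])), Nat.toPNat'_coe, if_pos]
    exact Nat.pos_of_ne_zero (h a (by simp))

theorem size_expsList {σ : Type*} [LinearOrder σ] (m : σ →₀ ℕ) :
    size (expsList m) = m.degree := by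
  rw [expsList, sum_toPNat _ _ (by simp), Finsupp.degree_apply, Finset.sum,
    ← Finset.sort_eq m.support (· ≤ ·), Multiset.map_coe, Multiset.sum_coe]

theorem length_le_size (α : List ℕ+) : α.length ≤ size α := by
  induction α with
  | nil => simp [size]
  | cons a l ih => 
    have := a.pos
    simp only [size, List.map_cons, List.sum_cons, List.length_cons] at *; omega

theorem finite_size_eq (n : ℕ) : {α : List ℕ+ | size α = n}.Finite := by
  refine Set.Finite.subset (Set.finite_range (fun c : Composition n =>
    c.blocks.map Nat.toPNat')) ?_
  intro α hα
  refine ⟨⟨α.map PNat.val, ?_, hα⟩, ?_⟩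
  · intro i hi
    obtain ⟨a, _, rfl⟩ := List.mem_map.1 hi
    exact a.pos
  · simp only [List.map_map]
    exact List.map_id'' (fun a => PNat.coe_toPNat' a) α

theorem coeffMul_support (G H : List ℕ+ →₀ ℂ) :
    (Function.support (coeffMul G H)).Finite := by
  classical
  refine Set.Finite.subset (Set.Finite.biUnion (G.support ×ˢ H.support).finite_toSet
    (fun p _ => finite_size_eq (size p.1 + size p.2))) ?_
  intro α hα
  rw [Function.mem_support, coeffMul, MvPowerSeries.coeff_mul] at hα
  obtain ⟨⟨a, b⟩, hab, hne⟩ := Finset.exists_ne_zero_of_sum_ne_zero hα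
  replace hab := Finset.HasAntidiagonal.mem_antidiagonal.1 hab
  simp only [coeff_qs] at hne
  simp only [Set.mem_iUnion, Set.mem_ofPred_eq]
  refine ⟨(expsList a, expsList b), ?_, ?_⟩
  · simpa using ⟨left_ne_zero_of_mul hne, right_ne_zero_of_mul hne⟩
  · simp only [size_expsList]
    rw [← map_add]
    simp only at hab
    rw [hab, Finsupp.degree_eq_sum]
    simp [size]

open Classical in
/-- The monomial quasisymmetric function `M_α = ∑_{i₁ < ⋯ < i_ℓ} x_{i₁}^{α₁} ⋯ x_{i_ℓ}^{α_ℓ}`, as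
a power series in the variables `x₀, x₁, …` over `ℂ`. The parts being positive, a monomial
occurs for at most one sequence `i`, so that every coefficient is `0` or `1`. -/
def monomialSeries (α : List ℕ+) : MvPowerSeries ℕ ℂ := fun m =>
  if ∃ i : Fin α.length → ℕ, StrictMono i ∧ m = ∑ k, Finsupp.single (i k) (α.get k : ℕ)
    then 1 else 0

theorem expsList_std (α : List ℕ+) :
    expsList (Finsupp.equivFunOnFinite.symm (fun i => ((α.get i : ℕ+) : ℕ))) = α := by
  rw [expsList]
  have : (Finsupp.equivFunOnFinite.symm (fun i => ((α.get i : ℕ+) : ℕ))).support =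
    Finset.univ := by ext; simp
  rw [this, Fin.sort_univ]
  apply List.ext_getElem
  · simp
  · intro i h1 h2
    simp

theorem embDomain_std (α : List ℕ+) (f : Fin α.length ↪o ℕ) :
    (Finsupp.equivFunOnFinite.symm (fun i => ((α.get i : ℕ+) : ℕ))).embDomain f.toEmbedding =
      ∑ k, Finsupp.single (f k) (α.get k : ℕ) := by
  rw [Finsupp.embDomain_eq_mapDomain, Finsupp.mapDomain, Finsupp.sum_fintype _ _ (by simp)]
  rfl

theorem coeff_monomialSeries (α : List ℕ+) (m : ℕ →₀ ℕ) :
    MvPowerSeries.coeff m (monomialSeries α) = if expsList m = α then 1 else 0 := by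
  have h : (∃ i : Fin α.length → ℕ, StrictMono i ∧
      m = ∑ k, Finsupp.single (i k) (α.get k : ℕ)) ↔ expsList m = α := by
    constructor
    · rintro ⟨i, hi, rfl⟩
      have := embDomain_std α (OrderEmbedding.ofStrictMono i hi)
      simp only [OrderEmbedding.coe_ofStrictMono] at this
      rw [← this, expsList_embDomain, expsList_std]
    · rintro rfl
      obtain ⟨f, hf⟩ := exists_compress m
      exact ⟨f, f.strictMono, hf.trans (embDomain_std _ f)⟩
  have h2 : MvPowerSeries.coeff m (monomialSeries α) = monomialSeries α m := rfl
  rw [h2, monomialSeries]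
  simp only [h]

theorem monomialSeries_eq (α : List ℕ+) :
    monomialSeries α = qs ℕ (Finsupp.single α (1 : ℂ)) := by
  classical
  ext m
  rw [coeff_qs, Finsupp.single_apply, coeff_monomialSeries]
  simp [eq_comm]

theorem qs_eq_sum (G : List ℕ+ →₀ ℂ) :
    qs ℕ G = G.sum (fun α c => c • monomialSeries α) := by
  classical
  ext m
  rw [Finsupp.sum, map_sum, coeff_qs]
  simp only [monomialSeries_eq, map_smul, coeff_qs, Finsupp.single_apply]
  simp +contextual

theorem mem_span_iff (f : MvPowerSeries ℕ ℂ) :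
    f ∈ Submodule.span ℂ (Set.range monomialSeries) ↔ ∃ G : List ℕ+ →₀ ℂ, f = qs ℕ G := by
  rw [Finsupp.mem_span_range_iff_exists_finsupp]
  simp only [qs_eq_sum, eq_comm]

theorem expsList_zero {σ : Type*} [LinearOrder σ] : expsList (0 : σ →₀ ℕ) = [] := by
  simp [expsList]

theorem exists_expsList (α : List ℕ+) : ∃ m : ℕ →₀ ℕ, expsList m = α := by
  refine ⟨(Finsupp.equivFunOnFinite.symm (fun i => ((α.get i : ℕ+) : ℕ))).embDomain
    (Fin.valOrderEmb α.length).toEmbedding, ?_⟩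
  rw [expsList_embDomain, expsList_std]

theorem one_eq_monomialSeries : (1 : MvPowerSeries ℕ ℂ) = monomialSeries [] := by
  classical
  ext m
  rw [MvPowerSeries.coeff_one, coeff_monomialSeries]
  have : expsList m = [] ↔ m = 0 := by
    rw [← Finsupp.support_eq_empty, ← Finset.card_eq_zero, ← List.length_eq_zero_iff]
    simp [expsList]
  simp [this]

theorem mul_mem_span {f g : MvPowerSeries ℕ ℂ}
    (hf : f ∈ Submodule.span ℂ (Set.range monomialSeries))
    (hg : g ∈ Submodule.span ℂ (Set.range monomialSeries)) :
    f * g ∈ Submodule.span ℂ (Set.range monomialSeries) := by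
  rw [mem_span_iff] at *
  obtain ⟨G, rfl⟩ := hf
  obtain ⟨H, rfl⟩ := hg
  exact ⟨Finsupp.ofSupportFinite _ (coeffMul_support G H), qs_mul ℕ G H⟩

end QSym

open QSym in
/-- The algebra of quasisymmetric functions: the span of the `M_α`, with the product of power
series. -/
def QSym : Subalgebra ℂ (MvPowerSeries ℕ ℂ) :=
  (Submodule.span ℂ (Set.range monomialSeries)).toSubalgebra
    (by rw [one_eq_monomialSeries]; exact Submodule.subset_span ⟨_, rfl⟩)
    (fun _ _ => mul_mem_span)

namespace QSym

/-- `M_α` as an element of `QSym`. -/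
def M (α : List ℕ+) : QSym := ⟨monomialSeries α, Submodule.subset_span ⟨α, rfl⟩⟩

theorem coeff_M (α : List ℕ+) (m : ℕ →₀ ℕ) :
    MvPowerSeries.coeff m (M α : MvPowerSeries ℕ ℂ) = if expsList m = α then 1 else 0 :=
  coeff_monomialSeries α m

theorem linearIndependent_M : LinearIndependent ℂ M := by
  rw [linearIndependent_iff]
  intro G hG
  ext α
  obtain ⟨m, rfl⟩ := exists_expsList α
  have h1 : qs ℕ G = 0 := by
    rw [qs_eq_sum]
    have := congrArg (fun f : QSym => (f : MvPowerSeries ℕ ℂ)) hG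
    simpa [Finsupp.linearCombination_apply, Finsupp.sum, M] using this
  have := coeff_qs G m
  rw [h1] at this
  simpa using this.symm

theorem span_M : ⊤ ≤ Submodule.span ℂ (Set.range M) := by
  rintro ⟨f, hf⟩ -
  obtain ⟨G, hG⟩ := (mem_span_iff f).1 hf
  rw [Finsupp.mem_span_range_iff_exists_finsupp]
  refine ⟨G, Subtype.ext ?_⟩
  rw [qs_eq_sum] at hG
  simp [hG, Finsupp.sum, M]

/-- The monomial basis. -/
def basisM : Module.Basis (List ℕ+) ℂ QSym := Module.Basis.mk linearIndependent_M span_M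

@[simp] theorem basisM_apply (α : List ℕ+) : basisM α = M α := by simp [basisM]


theorem M_nil : M [] = 1 := Subtype.ext one_eq_monomialSeries.symm

/-- The counit, i.e. the constant term. -/
def counitHom : QSym →ₐ[ℂ] ℂ where
  toRingHom := (MvPowerSeries.constantCoeff (σ := ℕ) (R := ℂ)).comp QSym.val.toRingHom
  commutes' r := by
    show MvPowerSeries.constantCoeff (algebraMap ℂ (MvPowerSeries ℕ ℂ) r) = r
    rw [MvPowerSeries.algebraMap_apply]
    simp

theorem counitHom_M (α : List ℕ+) : counitHom (M α) = if α = [] then 1 else 0 := by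
  show MvPowerSeries.coeff 0 (M α : MvPowerSeries ℕ ℂ) = _
  rw [coeff_M, expsList_zero]
  simp [eq_comm]

/-- The coproduct `Δ(M_α) = ∑_{βγ = α} M_β ⊗ M_γ` (deconcatenation). -/
def comulMap : QSym →ₗ[ℂ] QSym ⊗[ℂ] QSym :=
  basisM.constr ℂ (fun α =>
    ∑ i ∈ Finset.range (α.length + 1), M (α.take i) ⊗ₜ[ℂ] M (α.drop i))

theorem comulMap_M (α : List ℕ+) : comulMap (M α) =
    ∑ i ∈ Finset.range (α.length + 1), M (α.take i) ⊗ₜ[ℂ] M (α.drop i) := by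
  rw [← basisM_apply, comulMap, Module.Basis.constr_basis]

instance instCoalgebra : Coalgebra ℂ QSym where
  comul := comulMap
  counit := counitHom.toLinearMap
  coassoc := by
    refine basisM.ext fun α => ?_
    simp only [basisM_apply, LinearMap.comp_apply, comulMap_M, map_sum, LinearMap.rTensor_tmul,
      LinearMap.lTensor_tmul, TensorProduct.sum_tmul, TensorProduct.tmul_sum,
      LinearEquiv.coe_coe, TensorProduct.assoc_tmul]
    rw [Finset.sum_sigma', Finset.sum_sigma']
    refine Finset.sum_bij' (fun p _ => ⟨p.2, p.1 - p.2⟩) (fun p _ => ⟨p.1 + p.2, p.1⟩) ?_ ?_ ?_ ?_ ?_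
    · rintro ⟨i, j⟩ h
      simp only [Finset.mem_sigma, Finset.mem_range, List.length_take, List.length_drop] at *
      omega
    · rintro ⟨i, j⟩ h
      simp only [Finset.mem_sigma, Finset.mem_range, List.length_take, List.length_drop] at *
      omega
    · rintro ⟨i, j⟩ h
      simp only [Finset.mem_sigma, Finset.mem_range, List.length_take] at *
      congr 1
      omega
    · rintro ⟨i, j⟩ h
      simp
    · rintro ⟨i, j⟩ h
      simp only [Finset.mem_sigma, Finset.mem_range, List.length_take] at *
      have h1 : j ≤ i := by omega
      rw [List.take_take, List.drop_drop, List.drop_take, min_eq_left h1,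
        Nat.add_sub_cancel' h1]
  rTensor_counit_comp_comul := by
    refine basisM.ext fun α => ?_
    simp only [basisM_apply, LinearMap.comp_apply, comulMap_M, map_sum, LinearMap.rTensor_tmul,
      AlgHom.toLinearMap_apply, counitHom_M]
    rw [Finset.sum_eq_single 0]
    · simp
    · intro i hi h0
      rw [if_neg, TensorProduct.zero_tmul]
      rw [← List.length_eq_zero_iff, List.length_take]
      simp at hi
      omega
    · simp
  lTensor_counit_comp_comul := by
    refine basisM.ext fun α => ?_
    simp only [basisM_apply, LinearMap.comp_apply, comulMap_M, map_sum, LinearMap.lTensor_tmul,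
      AlgHom.toLinearMap_apply, counitHom_M]
    rw [Finset.sum_eq_single α.length]
    · simp
    · intro i hi h0
      rw [if_neg, TensorProduct.tmul_zero]
      rw [← List.length_eq_zero_iff, List.length_drop]
      simp at hi
      omega
    · simp

theorem comul_M (α : List ℕ+) : Coalgebra.comul (R := ℂ) (M α) =
    ∑ i ∈ Finset.range (α.length + 1), M (α.take i) ⊗ₜ[ℂ] M (α.drop i) := comulMap_M α

/-! The coproduct is multiplicative: compare series in two sets of variables. -/

/-- `f ⊗ g ↦ f(x) g(y)`. -/
def twoAlphabets : QSym ⊗[ℂ] QSym →ₐ[ℂ] MvPowerSeries ℕ (MvPowerSeries ℕ ℂ) :=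
  Algebra.TensorProduct.productMap
    ((MvPowerSeries.mapAlgHom (σ := ℕ) (Algebra.ofId ℂ (MvPowerSeries ℕ ℂ))).comp QSym.val)
    ((AlgHom.mk (MvPowerSeries.C (σ := ℕ) (R := MvPowerSeries ℕ ℂ))
      (fun _ => (MvPowerSeries.algebraMap_apply (σ := ℕ) (R := ℂ) (A := MvPowerSeries ℕ ℂ)).symm)).comp QSym.val)

theorem coeff_twoAlphabets_tmul (f g : QSym) (m n : ℕ →₀ ℕ) :
    MvPowerSeries.coeff n (MvPowerSeries.coeff m (twoAlphabets (f ⊗ₜ g))) =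
      MvPowerSeries.coeff m (f : MvPowerSeries ℕ ℂ) *
        MvPowerSeries.coeff n (g : MvPowerSeries ℕ ℂ) := by
  have : twoAlphabets (f ⊗ₜ g) = (MvPowerSeries.map (algebraMap ℂ (MvPowerSeries ℕ ℂ)) f.1) *
    MvPowerSeries.C g.1 := by
    rw [twoAlphabets, Algebra.TensorProduct.productMap_apply_tmul]
    rfl
  rw [this, MvPowerSeries.coeff_mul_C, MvPowerSeries.coeff_map, ← Algebra.smul_def]
  simp

theorem twoAlphabets_injective : Function.Injective twoAlphabets := by
  classical
  rw [injective_iff_map_eq_zero]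
  intro x hx
  apply (basisM.tensorProduct basisM).repr.injective
  rw [map_zero]
  ext ⟨α, β⟩
  obtain ⟨m, rfl⟩ := exists_expsList α
  obtain ⟨n, rfl⟩ := exists_expsList β
  have key : ∀ y : QSym ⊗[ℂ] QSym, (basisM.tensorProduct basisM).repr y
      (expsList m, expsList n) =
      MvPowerSeries.coeff n (MvPowerSeries.coeff m (twoAlphabets y)) := by
    intro y
    have : (Finsupp.lapply (R := ℂ) (expsList m, expsList n)) ∘ₗ
        (basisM.tensorProduct basisM).repr.toLinearMap =
        (MvPowerSeries.coeff n) ∘ₗ ((MvPowerSeries.coeff m).restrictScalars ℂ) ∘ₗ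
          twoAlphabets.toLinearMap := by
      refine (basisM.tensorProduct basisM).ext ?_
      rintro ⟨α, β⟩
      simp only [LinearMap.comp_apply, LinearEquiv.coe_coe, 
        Finsupp.lapply_apply, AlgHom.toLinearMap_apply, Module.Basis.tensorProduct_apply,
        LinearMap.restrictScalars_apply, coeff_twoAlphabets_tmul, basisM_apply, coeff_M]
      simp only [Module.Basis.tensorProduct_repr_tmul_apply, ← basisM_apply, Module.Basis.repr_self,
        Finsupp.single_apply]
      simp [eq_comm, mul_comm]
    exact LinearMap.congr_fun this y
  rw [key, hx]
  simp


theorem coeff_twoAlphabets_comul (G : List ℕ+ →₀ ℂ) (f : QSym)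
    (hf : (f : MvPowerSeries ℕ ℂ) = qs ℕ G) (m n : ℕ →₀ ℕ) :
    MvPowerSeries.coeff n (MvPowerSeries.coeff m (twoAlphabets (comulMap f))) =
      G (expsList m ++ expsList n) := by
  classical
  have hfG : f = G.sum (fun α c => c • M α) := by
    apply Subtype.ext
    rw [hf, qs_eq_sum]
    simp [Finsupp.sum, M]
  have h1 : ∀ α, MvPowerSeries.coeff n (MvPowerSeries.coeff m (twoAlphabets (comulMap (M α)))) =
      if expsList m ++ expsList n = α then 1 else 0 := by
    intro α
    simp only [comulMap_M, map_sum, coeff_twoAlphabets_tmul, coeff_M]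
    split_ifs with h
    · subst h
      rw [Finset.sum_eq_single (expsList m).length]
      · simp
      · intro i hi hne
        rw [if_neg, zero_mul]
        intro h
        apply hne
        have := congrArg List.length h
        rw [List.length_take] at this
        simp only [List.length_append, Finset.mem_range] at *
        omega
      · simp
    · refine Finset.sum_eq_zero fun i _ => ?_
      by_cases h2 : expsList m = α.take i
      · rw [if_neg (c := expsList n = α.drop i), mul_zero]
        intro h3
        exact h (by rw [h2, h3, List.take_append_drop])
      · rw [if_neg h2, zero_mul]
  rw [hfG, Finsupp.sum]
  simp only [map_sum, map_smul]
  have h2 : ∀ (c : ℂ) (x : MvPowerSeries ℕ (MvPowerSeries ℕ ℂ)),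
      MvPowerSeries.coeff m (c • x) = c • MvPowerSeries.coeff m x := fun _ _ => rfl
  simp only [h2, map_smul, h1, smul_eq_mul]
  simp +contextual

/-- The monomial `m` followed by the monomial `n` shifted by `N` variables. -/
def glue (N : ℕ) (m n : ℕ →₀ ℕ) : ℕ →₀ ℕ := m + n.embDomain (addRightEmbedding N)

theorem glue_apply_lt {N : ℕ} (m n : ℕ →₀ ℕ) {i : ℕ} (hi : i < N) : glue N m n i = m i := by
  rw [glue, Finsupp.add_apply, Finsupp.embDomain_of_notMem_range, add_zero]
  rintro ⟨j, rfl⟩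
  simp at hi

theorem glue_apply_add {N : ℕ} (m n : ℕ →₀ ℕ) (hm : ∀ i, N ≤ i → m i = 0) (i : ℕ) :
    glue N m n (i + N) = n i := by
  rw [glue, Finsupp.add_apply, hm _ (Nat.le_add_left _ _), zero_add]
  exact Finsupp.embDomain_apply_self (addRightEmbedding N) n i

theorem expsList_glue {N : ℕ} (m n : ℕ →₀ ℕ) (hm : ∀ i, N ≤ i → m i = 0) :
    expsList (glue N m n) = expsList m ++ expsList n := by
  have hs : (glue N m n).support.sort =
      m.support.sort ++ n.support.sort.map (fun i => i + N) := by
    apply List.Perm.eq_of_pairwise' (r := (· ≤ ·))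
    · exact Finset.pairwise_sort _ _
    · rw [List.pairwise_append]
      refine ⟨Finset.pairwise_sort _ _, ?_, ?_⟩
      · rw [List.pairwise_map]
        exact (Finset.pairwise_sort n.support (· ≤ ·)).imp (by intro a b h; omega)
      · intro a ha b hb
        obtain ⟨c, _, rfl⟩ := List.mem_map.1 hb
        by_contra hab
        have : m a ≠ 0 := by simpa using ha
        exact this (hm a (by omega))
    · rw [List.perm_ext_iff_of_nodup]
      · intro a
        simp only [Finset.mem_sort, Finsupp.mem_support_iff, List.mem_append, List.mem_map]
        by_cases ha : a < N
        · rw [glue_apply_lt m n ha]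
          constructor
          · exact Or.inl
          · rintro (h | ⟨c, _, rfl⟩)
            · exact h
            · omega
        · obtain ⟨c, rfl⟩ : ∃ c, a = c + N := ⟨a - N, by omega⟩
          rw [glue_apply_add m n hm, hm _ (Nat.le_add_left _ _)]
          simp
      · exact Finset.sort_nodup _ _
      · rw [List.nodup_append]
        refine ⟨Finset.sort_nodup _ _, (Finset.sort_nodup _ _).map (fun a b h => by simpa using h), ?_⟩
        intro a ha b hb hab
        obtain ⟨c, _, rfl⟩ := List.mem_map.1 hb
        have : m a ≠ 0 := by simpa using ha
        exact this (hm a (by omega))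
  rw [expsList, hs, List.map_append, List.map_map]
  congr 1
  · apply List.map_congr_left
    intro a ha
    have : m a ≠ 0 := by simpa using ha
    rw [glue_apply_lt]
    by_contra h
    exact this (hm a (by omega))
  · apply List.map_congr_left
    intro a _
    simp only [Function.comp]
    rw [glue_apply_add m n hm]

theorem sum_antidiagonal_glue {N : ℕ} (m n : ℕ →₀ ℕ) (hm : ∀ i, N ≤ i → m i = 0)
    (F : (ℕ →₀ ℕ) → (ℕ →₀ ℕ) → ℂ) :
    ∑ p ∈ Finset.HasAntidiagonal.antidiagonal (glue N m n), F p.1 p.2 =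
      ∑ p ∈ Finset.HasAntidiagonal.antidiagonal m, ∑ q ∈ Finset.HasAntidiagonal.antidiagonal n,
        F (glue N p.1 q.1) (glue N p.2 q.2) := by
  classical
  have hadd : ∀ a b c d, glue N a b + glue N c d = glue N (a + c) (b + d) := by
    intro a b c d
    simp only [glue, Finsupp.embDomain_add]
    abel
  have hvan : ∀ a b : ℕ →₀ ℕ, a + b = m → (∀ i, N ≤ i → a i = 0) ∧ (∀ i, N ≤ i → b i = 0) := by
    intro a b h
    refine ⟨fun i hi => ?_, fun i hi => ?_⟩ <;>
    · have h1 := hm i hi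
      rw [← h, Finsupp.add_apply] at h1
      omega
  rw [← Finset.sum_product']
  symm
  refine Finset.sum_bij (fun p _ => (glue N p.1.1 p.2.1, glue N p.1.2 p.2.2)) ?_ ?_ ?_ ?_
  · rintro ⟨⟨a, a'⟩, ⟨b, b'⟩⟩ h
    simp only [Finset.mem_product, Finset.HasAntidiagonal.mem_antidiagonal] at *
    rw [hadd, h.1, h.2]
  · rintro ⟨⟨a, a'⟩, ⟨b, b'⟩⟩ h ⟨⟨c, c'⟩, ⟨d, d'⟩⟩ h' heq
    simp only [Finset.mem_product, Finset.HasAntidiagonal.mem_antidiagonal, Prod.mk.injEq] at *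
    have aux : ∀ a b c d : ℕ →₀ ℕ, (∀ i, N ≤ i → a i = 0) → (∀ i, N ≤ i → c i = 0) →
        glue N a b = glue N c d → a = c ∧ b = d := by
      intro a b c d ha hc h
      constructor
      · ext i
        by_cases hi : i < N
        · rw [← glue_apply_lt a b hi, h, glue_apply_lt c d hi]
        · rw [ha i (by omega), hc i (by omega)]
      · ext i
        rw [← glue_apply_add a b ha, h, glue_apply_add c d hc]
    obtain ⟨h1, h2⟩ := aux _ _ _ _ (hvan _ _ h.1).1 (hvan _ _ h'.1).1 heq.1
    obtain ⟨h3, h4⟩ := aux _ _ _ _ (hvan _ _ h.1).2 (hvan _ _ h'.1).2 heq.2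
    exact ⟨⟨h1, h3⟩, ⟨h2, h4⟩⟩
  · rintro ⟨u, v⟩ h
    simp only [Finset.HasAntidiagonal.mem_antidiagonal] at h
    have hsplit : ∀ w : ℕ →₀ ℕ, glue N (w.filter (fun j => j < N))
        (w.comapDomain (addRightEmbedding N) (addRightEmbedding N).injective.injOn) = w := by
      intro w
      ext i
      by_cases hi : i < N
      · rw [glue_apply_lt _ _ hi, Finsupp.filter_apply_pos (fun j => j < N) _ hi]
      · obtain ⟨c, rfl⟩ : ∃ c, i = c + N := ⟨i - N, by omega⟩
        rw [glue_apply_add]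
        · rfl
        · intro j hj
          exact Finsupp.filter_apply_neg (fun j => j < N) _ (by omega)
    refine ⟨((u.filter (fun j => j < N), v.filter (fun j => j < N)),
      (u.comapDomain (addRightEmbedding N) (addRightEmbedding N).injective.injOn,
       v.comapDomain (addRightEmbedding N) (addRightEmbedding N).injective.injOn)), ?_, ?_⟩
    · simp only [Finset.mem_product, Finset.HasAntidiagonal.mem_antidiagonal]
      constructor
      · ext i
        by_cases hi : i < N
        · rw [Finsupp.add_apply, Finsupp.filter_apply_pos (fun j => j < N) _ hi, Finsupp.filter_apply_pos (fun j => j < N) _ hi,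
            ← glue_apply_lt m n hi, ← h, Finsupp.add_apply]
        · rw [Finsupp.add_apply, Finsupp.filter_apply_neg (fun j => j < N) _ hi, Finsupp.filter_apply_neg (fun j => j < N) _ hi,
            hm i (by omega), add_zero]
      · ext i
        rw [← glue_apply_add m n hm, ← h]
        rfl
    · simp only [hsplit]
  · rintro ⟨⟨a, a'⟩, ⟨b, b'⟩⟩ h
    rfl

theorem comulMap_mul (f g : QSym) : comulMap (f * g) = comulMap f * comulMap g := by
  classical
  apply twoAlphabets_injective
  obtain ⟨G, hG⟩ := (mem_span_iff _).1 f.2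
  obtain ⟨H, hH⟩ := (mem_span_iff _).1 g.2
  have hK : ((f * g : QSym) : MvPowerSeries ℕ ℂ) =
      qs ℕ (Finsupp.ofSupportFinite _ (coeffMul_support G H)) := by
    show (f : MvPowerSeries ℕ ℂ) * (g : MvPowerSeries ℕ ℂ) = _
    rw [hG, hH]
    exact qs_mul ℕ G H
  ext m n
  obtain ⟨N, hN⟩ : ∃ N, ∀ i, N ≤ i → m i = 0 := by
    refine ⟨m.support.sup id + 1, fun i hi => ?_⟩
    by_contra h
    have := Finset.le_sup (f := id) (Finsupp.mem_support_iff.2 h)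
    simp only [id] at this
    omega
  rw [coeff_twoAlphabets_comul _ _ hK, map_mul, MvPowerSeries.coeff_mul, map_sum,
    ← expsList_glue m n hN, ← coeff_qs (Finsupp.ofSupportFinite _ (coeffMul_support G H)), ← hK]
  show MvPowerSeries.coeff _ ((f : MvPowerSeries ℕ ℂ) * (g : MvPowerSeries ℕ ℂ)) = _
  rw [MvPowerSeries.coeff_mul, sum_antidiagonal_glue m n hN (fun a b =>
    MvPowerSeries.coeff a (f : MvPowerSeries ℕ ℂ) * MvPowerSeries.coeff b (g : MvPowerSeries ℕ ℂ))]
  refine Finset.sum_congr rfl fun p hp => ?_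
  rw [MvPowerSeries.coeff_mul]
  refine Finset.sum_congr rfl fun q hq => ?_
  have hp' := Finset.HasAntidiagonal.mem_antidiagonal.1 hp
  have h1 : ∀ i, N ≤ i → p.1 i = 0 := fun i hi => by
    have := hN i hi
    rw [← hp', Finsupp.add_apply] at this
    omega
  have h2 : ∀ i, N ≤ i → p.2 i = 0 := fun i hi => by
    have := hN i hi
    rw [← hp', Finsupp.add_apply] at this
    omega
  rw [coeff_twoAlphabets_comul _ _ hG, coeff_twoAlphabets_comul _ _ hH,
    ← expsList_glue _ _ h1, ← expsList_glue _ _ h2, hG, hH, coeff_qs, coeff_qs]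

instance instBialgebra : Bialgebra ℂ QSym :=
  Bialgebra.mk' ℂ QSym (map_one counitHom) (map_mul counitHom _ _)
    (by
      show comulMap 1 = 1
      rw [← M_nil, comulMap_M]
      simp [M_nil, Algebra.TensorProduct.one_def])
    (comulMap_mul _ _)

/-- The antipode on `M_α`: `∑_{βγ = α} S(M_β) M_γ = ε(M_α)` solved for `S(M_α)`. -/
def antipodeM (α : List ℕ+) : QSym :=
  if α = [] then 1 else -∑ i : Fin α.length, antipodeM (α.take i) * M (α.drop i)
termination_by α.length
decreasing_by simp

/-- The right convolution inverse of the identity, constructed in the same way. -/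
def antipodeR (α : List ℕ+) : QSym :=
  if α = [] then 1 else -∑ i : Fin α.length, M (α.take (i + 1)) * antipodeR (α.drop (i + 1))
termination_by α.length
decreasing_by
  have := i.2
  simp only [List.length_drop]
  omega

theorem antipodeM_eq (α : List ℕ+) : antipodeM α =
    if α = [] then 1 else -∑ i : Fin α.length, antipodeM (α.take i) * M (α.drop i) := by
  rw [antipodeM]

theorem antipodeR_eq (α : List ℕ+) : antipodeR α =
    if α = [] then 1 else
      -∑ i : Fin α.length, M (α.take (i + 1)) * antipodeR (α.drop (i + 1)) := by
  rw [antipodeR]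

/-- The antipode of `QSym`. -/
def antipodeMap : QSym →ₗ[ℂ] QSym := basisM.constr ℂ antipodeM

open WithConv in
theorem antipode_conv_id :
    (toConv antipodeMap : WithConv (QSym →ₗ[ℂ] QSym)) * toConv LinearMap.id = 1 := by
  ext1
  refine basisM.ext fun α => ?_
  rw [basisM_apply, LinearMap.convMul_apply, LinearMap.convOne_apply, comul_M]
  simp only [map_sum, TensorProduct.map_tmul, LinearMap.mul'_apply, LinearMap.id_apply]
  have h : ∀ β, antipodeMap (M β) = antipodeM β := fun β => by
    rw [← basisM_apply, antipodeMap, Module.Basis.constr_basis]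
  have hc : Coalgebra.counit (R := ℂ) (M α) = if α = [] then 1 else 0 := counitHom_M α
  simp only [h]
  rw [Finset.sum_range_succ, hc]
  by_cases hα : α = []
  · subst hα
    simp [antipodeM_eq [], M_nil]
  · rw [List.take_length, List.drop_length, M_nil, mul_one, if_neg hα, map_zero]
    rw [antipodeM_eq α]
    rw [if_neg hα, Finset.sum_range, add_neg_cancel]

open WithConv in
theorem id_conv_antipodeR :
    (toConv LinearMap.id : WithConv (QSym →ₗ[ℂ] QSym)) * toConv (basisM.constr ℂ antipodeR) = 1 := by
  ext1
  refine basisM.ext fun α => ?_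
  rw [basisM_apply, LinearMap.convMul_apply, LinearMap.convOne_apply, comul_M]
  simp only [map_sum, TensorProduct.map_tmul, LinearMap.mul'_apply, LinearMap.id_apply]
  have h : ∀ β, basisM.constr ℂ antipodeR (M β) = antipodeR β := fun β => by
    rw [← basisM_apply, Module.Basis.constr_basis]
  have hc : Coalgebra.counit (R := ℂ) (M α) = if α = [] then 1 else 0 := counitHom_M α
  simp only [h]
  rw [Finset.sum_range_succ', hc]
  by_cases hα : α = []
  · subst hα
    simp [antipodeR_eq [], M_nil]
  · rw [List.take_zero, List.drop_zero, M_nil, one_mul, if_neg hα, map_zero]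
    rw [antipodeR_eq α]
    rw [if_neg hα, Finset.sum_range, add_neg_cancel]

open WithConv in
instance instHopfAlgebra : HopfAlgebra ℂ QSym where
  antipode := antipodeMap
  mul_antipode_rTensor_comul := congrArg ofConv antipode_conv_id
  mul_antipode_lTensor_comul := by
    have h := antipode_conv_id
    rw [left_inv_eq_right_inv antipode_conv_id id_conv_antipodeR] at h
    have h2 := id_conv_antipodeR
    rw [← left_inv_eq_right_inv antipode_conv_id id_conv_antipodeR] at h2
    exact congrArg ofConv h2


/-- The homogeneous component `QSym_n`, the span of the `M_α` with `|α| = n`. -/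
def homogeneous (n : ℕ) : Submodule ℂ QSym := Submodule.span ℂ (M '' {α | size α = n})

theorem exists_poly (f : QSym) : ∃ p : Polynomial ℂ, ∀ k,
    MvPowerSeries.coeff (Finsupp.single 0 k) (f : MvPowerSeries ℕ ℂ) = p.coeff k := by
  classical
  obtain ⟨G, hG⟩ := (mem_span_iff _).1 f.2
  refine ⟨∑ j ∈ G.support.image size, Polynomial.monomial j (MvPowerSeries.coeff
    (Finsupp.single 0 j) (f : MvPowerSeries ℕ ℂ)), fun k => ?_⟩
  rw [Polynomial.finsetSum_coeff]
  simp only [Polynomial.coeff_monomial]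
  rw [Finset.sum_ite_eq' (G.support.image size) k]
  split_ifs with h
  · rfl
  · rw [hG, coeff_qs]
    by_contra hne
    apply h
    refine Finset.mem_image.2 ⟨_, Finsupp.mem_support_iff.2 hne, ?_⟩
    rw [size_expsList]
    simp

/-- `f ↦ f(1, 0, 0, …)`: the sum of the coefficients of the powers of the first variable. Only
finitely many of them are nonzero. -/
def zetaFun (f : QSym) : ℂ :=
  ∑ᶠ k : ℕ, MvPowerSeries.coeff (Finsupp.single 0 k) (f : MvPowerSeries ℕ ℂ)

theorem zetaFun_eq (f : QSym) (p : Polynomial ℂ)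
    (h : ∀ k, MvPowerSeries.coeff (Finsupp.single 0 k) (f : MvPowerSeries ℕ ℂ) = p.coeff k) :
    zetaFun f = p.eval 1 := by
  rw [zetaFun, Polynomial.eval_eq_sum]
  simp only [h, one_pow, mul_one]
  rw [finsum_eq_sum_of_support_subset (s := p.support)]
  · rfl
  · intro k hk
    simpa using hk

/-- The canonical character `ζ(f) = f(1, 0, 0, …)` of `QSym`. -/
def zeta : QSym →ₐ[ℂ] ℂ where
  toFun := zetaFun
  map_one' := by
    classical
    rw [zetaFun_eq 1 1]
    · simp
    · intro k
      show MvPowerSeries.coeff _ (1 : MvPowerSeries ℕ ℂ) = _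
      rw [MvPowerSeries.coeff_one, Polynomial.coeff_one]
      simp
  map_mul' f g := by
    obtain ⟨p, hp⟩ := exists_poly f
    obtain ⟨q, hq⟩ := exists_poly g
    rw [zetaFun_eq f p hp, zetaFun_eq g q hq, ← Polynomial.eval_mul]
    apply zetaFun_eq
    intro k
    classical
    show MvPowerSeries.coeff _ ((f : MvPowerSeries ℕ ℂ) * (g : MvPowerSeries ℕ ℂ)) = _
    rw [MvPowerSeries.coeff_mul, Finsupp.antidiagonal_single, Finset.sum_map,
      Polynomial.coeff_mul]
    simp [hp, hq]
  map_zero' := by simp [zetaFun]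
  map_add' f g := by
    obtain ⟨p, hp⟩ := exists_poly f
    obtain ⟨q, hq⟩ := exists_poly g
    rw [zetaFun_eq f p hp, zetaFun_eq g q hq, ← Polynomial.eval_add]
    apply zetaFun_eq
    intro k
    simp [hp, hq]
  commutes' r := by
    classical
    have : zetaFun (algebraMap ℂ QSym r) = (Polynomial.C r).eval 1 := by
      apply zetaFun_eq
      intro k
      show MvPowerSeries.coeff _ (algebraMap ℂ (MvPowerSeries ℕ ℂ) r) = _
      rw [MvPowerSeries.algebraMap_apply, MvPowerSeries.coeff_C, Polynomial.coeff_C]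
      simp
    rw [this]
    simp

/-- The functional that is `(-1)^n χ` on `QSym_n`. -/
def bar (χ : QSym →ₗ[ℂ] ℂ) : QSym →ₗ[ℂ] ℂ :=
  basisM.constr ℂ (fun α => (-1) ^ size α * χ (M α))

/-- The convolution product `χ ψ = m ∘ (χ ⊗ ψ) ∘ Δ`. -/
def conv (χ ψ : QSym →ₗ[ℂ] ℂ) : QSym →ₗ[ℂ] ℂ :=
  (WithConv.toConv χ * WithConv.toConv ψ : WithConv (QSym →ₗ[ℂ] ℂ)).ofConv

/-- The inverse character `ζ⁻¹ = ζ ∘ S`, with `S` the antipode. -/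
def zetaInv : QSym →ₗ[ℂ] ℂ := zeta.toLinearMap ∘ₗ HopfAlgebra.antipode ℂ

/-- The character `bar(ζ⁻¹) ζ`. -/
def thetaCharacter : QSym →ₗ[ℂ] ℂ := conv (bar zetaInv) zeta.toLinearMap

/-- `Θ` is a morphism of combinatorial Hopf algebras `(QSym, bar(ζ⁻¹) ζ) → (QSym, ζ)`: a graded
morphism of Hopf algebras (a bialgebra morphism between Hopf algebras commutes with the
antipodes) such that `ζ ∘ Θ = bar(ζ⁻¹) ζ`. -/
structure IsThetaMap (Θ : QSym →ₐc[ℂ] QSym) : Prop where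
  graded : ∀ n, ∀ f ∈ homogeneous n, Θ f ∈ homogeneous n
  character : ∀ f, zeta (Θ f) = thetaCharacter f


/-- The partial sum `α₁ + ⋯ + α_i`. -/
def psum (α : List ℕ+) (i : ℕ) : ℕ := size (α.take i)

/-- The set `{α₁, α₁ + α₂, …, α₁ + ⋯ + α_{ℓ-1}}`. -/
def partialSums (α : List ℕ+) : Finset ℕ := (Finset.Ioo 0 α.length).image (psum α)

/-- `β ≤ α`, i.e. `α` refines `β`. -/
def Coarsens (β α : List ℕ+) : Prop := size β = size α ∧ partialSums β ⊆ partialSums α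

/-- The odd-min composition `m_o(α)`: cut `α` between consecutive parts `α_i` odd, `α_{i+1}` even,
and replace each of the (nonempty) segments by its sum. -/
def oddMin (α : List ℕ+) : List ℕ+ :=
  (α.splitBy (fun a b : ℕ+ => !(decide (Odd (a : ℕ)) && decide (Even (b : ℕ))))).map
    (fun block => (size block).toPNat')

/-- For `β ≤ α`, the number of odd parts of `α` among the consecutive parts of `α` that add up to
the part of `β` with (zero-based) index `i`. -/
def oddParts (α β : List ℕ+) (i : ℕ) : ℕ :=
  (Finset.univ.filter (fun j : Fin α.length =>
    Odd (α.get j : ℕ) ∧ psum β i ≤ psum α j ∧ psum α j < psum β (i + 1))).card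

/-- For `β ≤ α`, the number of even parts of `α` among the consecutive parts of `α` that add up to
the part of `β` with (zero-based) index `i`. -/
def evenParts (α β : List ℕ+) (i : ℕ) : ℕ :=
  (Finset.univ.filter (fun j : Fin α.length =>
    Even (α.get j : ℕ) ∧ psum β i ≤ psum α j ∧ psum α j < psum β (i + 1))).card

/-- The coefficient `c_α^β = ∏_i 1 / (O_α^β(i)! E_α^β(i)!)`. -/
def shuffleCoeff (α β : List ℕ+) : ℂ :=
  ∏ i ∈ Finset.range β.length,
    1 / (((oddParts α β i).factorial : ℂ) * ((evenParts α β i).factorial : ℂ))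

open Classical in
/-- The shuffle function `S_α = ∑_{m_o(α) ≤ β ≤ α} c_α^β M_β`. -/
def S (α : List ℕ+) : QSym :=
  ∑ β ∈ (finite_size_eq (size α)).toFinset.filter
    (fun β => Coarsens (oddMin α) β ∧ Coarsens β α), shuffleCoeff α β • M β

/-- All parts are odd. -/
def IsOdd (α : List ℕ+) : Prop := ∀ a ∈ α, Odd (a : ℕ)

/-- The image of a theta map. -/
def peakAlgebra (Θ : QSym →ₐc[ℂ] QSym) : Submodule ℂ QSym :=
  LinearMap.range (Θ : QSym →ₗ[ℂ] QSym)

end QSym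

end

noncomputable section
open scoped TensorProduct

namespace QSym

open WithConv

/-! The coproduct of `QSym` is deconcatenation, so in the convolution algebra of functionals the
coefficient at `M_β` is the product of the coefficients at the one-part functions `M_b`, `b` running
through the parts of `β`. Two consequences (cofreeness) carry the proof. A coalgebra map into `QSym`
is determined by its coefficients at the `M_b` (`coalgHom_ext`). Conversely, any function `t` on
compositions gives a degree-preserving coalgebra endomorphism `cofree t`, whose coefficient at `M_b`
is `t` on degree `b`. On degree `b > 0` the coefficient at `M_b` is `ζ`, so graded coalgebra
endomorphisms are compared by composing with `ζ`.

The map `Θ` is `cofree` applied to the character `bar(ζ⁻¹) ζ`. It is multiplicative because `Θ ∘ m`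
and `m ∘ (Θ ⊗ Θ)` are coalgebra maps whose coefficients at each `M_b` agree, the functional being a
character. Uniqueness is `coalgHom_ext` again.

The recursion on the first part of `β` shows that `M_α ↦ S_α` is the coalgebra map `shuffleHom =
cofree shuffleWeight` (`components_shuffleWeight`). Its weight is `1/(O! E!)` when all even parts of
`α` precede all odd ones and `0` otherwise, that is, a convolution product `exp(e) exp(o)` of
exponentials of the sums `e`, `o` of the even and odd one-part coefficients. Thus `shuffleHom` pulls
`ζ` back to `exp(e) exp(o)` and `ζ⁻¹` to `exp(-o) exp(-e)`. The bar changes the sign of `o` only, so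
the character pulls back to `exp(o) exp(-e) exp(e) exp(o) = exp(2o)`. Its value at `M_α` is `2^ℓ/ℓ!`
if all parts are odd and `0` otherwise, which is the claimed eigenvalue times the weight; cofreeness
turns this equality of functionals into `theta_S`.

Finally `S_α` is `M_α` plus shorter terms of the same degree, which gives the basis statements, and
the image of `Θ` is read off from the eigenvalues. -/

/-! ### Coefficient functionals and the convolution algebra -/

theorem size_nil : size [] = 0 := rfl

theorem size_cons (a : ℕ+) (α : List ℕ+) : size (a :: α) = a + size α := by simp [size]

theorem size_append (α β : List ℕ+) : size (α ++ β) = size α + size β := by simp [size]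

theorem size_eq_zero {α : List ℕ+} : size α = 0 ↔ α = [] := by
  refine ⟨fun h => ?_, fun h => h ▸ rfl⟩
  have := length_le_size α
  exact List.length_eq_zero_iff.1 (by omega)

theorem size_take_add_drop (α : List ℕ+) (i : ℕ) :
    size (α.take i) + size (α.drop i) = size α := by
  rw [← size_append, List.take_append_drop]

/-- The coefficient of `M_β`, as an element of the convolution algebra of functionals. -/
def coeffM (β : List ℕ+) : WithConv (QSym →ₗ[ℂ] ℂ) := toConv (basisM.coord β)

theorem coeffM_M (α β : List ℕ+) : coeffM β (M α) = if α = β then 1 else 0 := by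
  classical
  show basisM.coord β (M α) = _
  rw [← basisM_apply, Module.Basis.coord_apply, Module.Basis.repr_self, Finsupp.single_apply]

theorem functional_ext {f g : WithConv (QSym →ₗ[ℂ] ℂ)} (h : ∀ α, f (M α) = g (M α)) : f = g := by
  apply WithConv.ofConv_injective
  refine basisM.ext fun α => ?_
  rw [basisM_apply]
  exact h α

theorem ext_coeffM {f g : QSym} (h : ∀ β, coeffM β f = coeffM β g) : f = g :=
  basisM.ext_elem h

theorem conv_M (f g : WithConv (QSym →ₗ[ℂ] ℂ)) (α : List ℕ+) :
    (f * g) (M α) =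
      ∑ i ∈ Finset.range (α.length + 1), f (M (α.take i)) * g (M (α.drop i)) := by
  rw [LinearMap.convMul_apply, comul_M]
  simp

theorem one_M (α : List ℕ+) :
    (1 : WithConv (QSym →ₗ[ℂ] ℂ)) (M α) = if α = [] then 1 else 0 := by
  rw [LinearMap.convOne_apply]
  exact counitHom_M α

theorem coeffM_nil : coeffM [] = 1 := functional_ext fun α => by rw [coeffM_M, one_M]

/-- Concatenation is dual to deconcatenation: exactly one cut of `β ++ γ` yields the pair `(β, γ)`.
-/
theorem coeffM_append (β γ : List ℕ+) : coeffM (β ++ γ) = coeffM β * coeffM γ := by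
  refine functional_ext fun α => ?_
  rw [conv_M, coeffM_M]
  simp only [coeffM_M]
  split_ifs with h
  · subst h
    rw [Finset.sum_eq_single β.length]
    · simp
    · intro i hi hne
      rw [if_neg, zero_mul]
      intro h
      apply hne
      have := congrArg List.length h
      simp only [List.length_take, List.length_append, Finset.mem_range] at *
      omega
    · simp
  · refine (Finset.sum_eq_zero fun i _ => ?_).symm
    by_cases h1 : α.take i = β
    · rw [if_neg (c := α.drop i = γ), mul_zero]
      rintro rfl
      exact h (by rw [← h1, List.take_append_drop])
    · rw [if_neg h1, zero_mul]

theorem coeffM_eq_prod (β : List ℕ+) : coeffM β = (β.map fun b => coeffM [b]).prod := by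
  induction β with
  | nil => simp [coeffM_nil]
  | cons b β ih => rw [List.map_cons, List.prod_cons, ← ih, ← coeffM_append, List.singleton_append]

/-- Precomposition with a coalgebra map respects convolution products, the empty one included. This
reduces all coefficients of the map to those at one-part compositions. -/
theorem comp_list_prod {C : Type*} [AddCommGroup C] [Module ℂ C] [Coalgebra ℂ C]
    (F : C →ₗc[ℂ] QSym) (l : List (WithConv (QSym →ₗ[ℂ] ℂ))) :
    toConv (l.prod.ofConv.comp F.toLinearMap) =
      (l.map fun f => toConv (f.ofConv.comp F.toLinearMap)).prod := by
  induction l with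
  | nil =>
    simp only [List.map_nil, List.prod_nil]
    ext c
    show algebraMap ℂ ℂ (Coalgebra.counit (R := ℂ) (F c)) = algebraMap ℂ ℂ (Coalgebra.counit (R := ℂ) c)
    rw [CoalgHomClass.counit_comp_apply]
  | cons f l ih =>
    rw [List.prod_cons, LinearMap.convMul_comp_coalgHom_distrib, List.map_cons, List.prod_cons, ih]

/-- A coalgebra map to `QSym` is determined by the coefficients of the `M_n`. -/
theorem coalgHom_ext {C : Type*} [AddCommGroup C] [Module ℂ C] [Coalgebra ℂ C]
    {F G : C →ₗc[ℂ] QSym} (h : ∀ (b : ℕ+) (c : C), coeffM [b] (F c) = coeffM [b] (G c)) :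
    F = G := by
  apply CoalgHom.ext
  intro c
  refine ext_coeffM fun β => ?_
  have key : ∀ H : C →ₗc[ℂ] QSym, coeffM β (H c) =
      ((β.map fun b => coeffM [b]).map fun f => toConv (f.ofConv.comp H.toLinearMap)).prod c := by
    intro H
    rw [← comp_list_prod, ← coeffM_eq_prod]
    rfl
  rw [key F, key G, List.map_map, List.map_map]
  refine congrArg (fun l : List (WithConv (C →ₗ[ℂ] ℂ)) => l.prod c) (List.map_congr_left fun b _ => ?_)
  ext x
  exact h b x

/-! ### Cofreeness: coalgebra endomorphisms with prescribed weights -/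

/-- The functional `M_α ↦ t(α)` for `|α| = n`, and `0` in the other degrees. -/
def component (t : List ℕ+ → ℂ) (n : ℕ) : WithConv (QSym →ₗ[ℂ] ℂ) :=
  toConv (basisM.constr ℂ fun α => if size α = n then t α else 0)

theorem component_M (t : List ℕ+ → ℂ) (n : ℕ) (α : List ℕ+) :
    component t n (M α) = if size α = n then t α else 0 := by
  show basisM.constr ℂ _ (M α) = _
  rw [← basisM_apply, Module.Basis.constr_basis]

/-- The convolution product of the components of `t` of degrees `β₁, β₂, …`. -/
def components (t : List ℕ+ → ℂ) (β : List ℕ+) : WithConv (QSym →ₗ[ℂ] ℂ) :=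
  (β.map fun b => component t b).prod

theorem components_nil (t : List ℕ+ → ℂ) : components t [] = 1 := rfl

theorem components_cons (t : List ℕ+ → ℂ) (b : ℕ+) (β : List ℕ+) :
    components t (b :: β) = component t b * components t β := by simp [components]

theorem components_append (t : List ℕ+ → ℂ) (β γ : List ℕ+) :
    components t (β ++ γ) = components t β * components t γ := by simp [components]

theorem components_M_eq_zero (t : List ℕ+ → ℂ) {α β : List ℕ+} (h : size β ≠ size α) :
    components t β (M α) = 0 := by
  induction β generalizing α with
  | nil =>
    rw [components_nil, one_M, if_neg]
    rintro rfl
    exact h rfl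
  | cons b β ih =>
    rw [components_cons, conv_M]
    refine Finset.sum_eq_zero fun i _ => ?_
    rw [component_M]
    split_ifs with h1
    · rw [ih, mul_zero]
      have := size_take_add_drop α i
      rw [size_cons] at h
      omega
    · rw [zero_mul]

/-- The linear map underlying `cofree`. -/
def cofreeMap (t : List ℕ+ → ℂ) : QSym →ₗ[ℂ] QSym :=
  basisM.constr ℂ fun α =>
    ∑ β ∈ (finite_size_eq (size α)).toFinset, components t β (M α) • M β

theorem cofreeMap_M (t : List ℕ+ → ℂ) (α : List ℕ+) : cofreeMap t (M α) =
    ∑ β ∈ (finite_size_eq (size α)).toFinset, components t β (M α) • M β := by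
  have h := basisM.constr_basis ℂ (fun α : List ℕ+ =>
    ∑ β ∈ (finite_size_eq (size α)).toFinset, components t β (M α) • M β) α
  rwa [basisM_apply] at h

/-- Restricting the sum in `cofreeMap` to compositions of size `|α|` loses nothing, because
`components t β` vanishes outside degree `|β|`. -/
theorem coeffM_cofreeMap (t : List ℕ+ → ℂ) (β : List ℕ+) (f : QSym) :
    coeffM β (cofreeMap t f) = components t β f := by
  suffices h : (coeffM β).ofConv ∘ₗ cofreeMap t = (components t β).ofConv from
    LinearMap.congr_fun h f
  refine basisM.ext fun α => ?_
  rw [basisM_apply, LinearMap.comp_apply, cofreeMap_M]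
  show coeffM β (∑ γ ∈ _, _) = components t β (M α)
  have hs : ∀ (s : Finset (List ℕ+)) (g : List ℕ+ → QSym),
      coeffM β (∑ γ ∈ s, g γ) = ∑ γ ∈ s, coeffM β (g γ) := fun s g => map_sum (coeffM β).ofConv g s
  have hm : ∀ (c : ℂ) (g : QSym), coeffM β (c • g) = c * coeffM β g :=
    fun c g => map_smul (coeffM β).ofConv c g
  simp only [hs, hm, coeffM_M, mul_ite, mul_one, mul_zero, Finset.sum_ite_eq']
  split_ifs with h
  · rfl
  · exact (components_M_eq_zero t (by simpa using h)).symm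

theorem tensor_ext {x y : QSym ⊗[ℂ] QSym}
    (h : ∀ β γ, LinearMap.mul' ℂ ℂ (TensorProduct.map (coeffM β).ofConv (coeffM γ).ofConv x) =
      LinearMap.mul' ℂ ℂ (TensorProduct.map (coeffM β).ofConv (coeffM γ).ofConv y)) : x = y := by
  refine (basisM.tensorProduct basisM).ext_elem ?_
  rintro ⟨β, γ⟩
  have key : (LinearMap.mul' ℂ ℂ) ∘ₗ TensorProduct.map (coeffM β).ofConv (coeffM γ).ofConv =
      (basisM.tensorProduct basisM).coord (β, γ) := by
    apply TensorProduct.ext'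
    intro f g
    simp [coeffM, mul_comm]
  have := h β γ
  simp only [← LinearMap.comp_apply, key] at this
  exact this

/-- The coalgebra endomorphism of `QSym` whose coefficient at `M_b` is `t` on degree `b`. -/
def cofree (t : List ℕ+ → ℂ) : QSym →ₗc[ℂ] QSym where
  __ := cofreeMap t
  counit_comp := by
    ext f
    have h : ∀ g : QSym, Coalgebra.counit (R := ℂ) g = coeffM [] g := fun g => by
      rw [coeffM_nil, LinearMap.convOne_apply]
      rfl
    show Coalgebra.counit (R := ℂ) (cofreeMap t f) = Coalgebra.counit (R := ℂ) f
    rw [h, h, coeffM_cofreeMap, components_nil, coeffM_nil]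
  map_comp_comul := by
    ext f : 1
    -- Tested against the coordinates at `M_β ⊗ M_γ`, compatibility with the coproduct becomes
    -- multiplicativity of `components t` under concatenation.
    refine tensor_ext fun β γ => ?_
    have h : ∀ δ, (coeffM δ).ofConv ∘ₗ cofreeMap t = (components t δ).ofConv :=
      fun δ => LinearMap.ext fun g => coeffM_cofreeMap t δ g
    rw [LinearMap.comp_apply, LinearMap.comp_apply, ← LinearMap.comp_apply (TensorProduct.map _ _),
      ← TensorProduct.map_comp]
    show LinearMap.mul' ℂ ℂ (TensorProduct.map ((coeffM β).ofConv ∘ₗ cofreeMap t)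
        ((coeffM γ).ofConv ∘ₗ cofreeMap t) (Coalgebra.comul f)) =
      (coeffM β * coeffM γ) (cofreeMap t f)
    rw [h, h, ← coeffM_append, coeffM_cofreeMap, components_append]
    rfl

theorem coeffM_cofree (t : List ℕ+ → ℂ) (β : List ℕ+) (f : QSym) :
    coeffM β (cofree t f) = components t β f := coeffM_cofreeMap t β f

theorem coeffM_singleton_cofree (t : List ℕ+ → ℂ) (b : ℕ+) (α : List ℕ+) :
    coeffM [b] (cofree t (M α)) = if size α = b then t α else 0 := by
  rw [coeffM_cofree, components_cons, components_nil, mul_one, component_M]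

/-! ### The grading and the canonical character -/

theorem M_mem_homogeneous (α : List ℕ+) : M α ∈ homogeneous (size α) :=
  Submodule.subset_span ⟨α, rfl, rfl⟩

theorem cofree_mem_homogeneous (t : List ℕ+ → ℂ) (n : ℕ) {f : QSym} (hf : f ∈ homogeneous n) :
    cofree t f ∈ homogeneous n := by
  suffices h : homogeneous n ≤ (homogeneous n).comap (cofreeMap t) from @h f hf
  refine Submodule.span_le.2 ?_
  rintro _ ⟨α, rfl, rfl⟩
  show cofreeMap t (M α) ∈ homogeneous (size α)
  rw [cofreeMap_M]
  refine Submodule.sum_mem _ fun β hβ => Submodule.smul_mem _ _ ?_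
  have : size β = size α := by simpa using hβ
  rw [← this]
  exact M_mem_homogeneous β

theorem mem_homogeneous_iff (n : ℕ) (f : QSym) :
    f ∈ homogeneous n ↔ ∀ α, size α ≠ n → coeffM α f = 0 := by
  have h : homogeneous n = Submodule.span ℂ (basisM '' {α | size α = n}) := by
    simp only [homogeneous, funext basisM_apply]
  rw [h, Module.Basis.mem_span_image]
  constructor
  · intro h α hα
    by_contra hne
    exact hα (h (Finsupp.mem_support_iff.2 hne))
  · intro h α hα
    by_contra hne
    exact (Finsupp.mem_support_iff.1 hα) (h α hne)

theorem coeff_eq_coeffM (f : QSym) (m : ℕ →₀ ℕ) :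
    MvPowerSeries.coeff m (f : MvPowerSeries ℕ ℂ) = coeffM (expsList m) f := by
  suffices h : MvPowerSeries.coeff m ∘ₗ QSym.val.toLinearMap = (coeffM (expsList m)).ofConv from
    LinearMap.congr_fun h f
  refine basisM.ext fun α => ?_
  rw [basisM_apply, coeffM_M]
  show MvPowerSeries.coeff m (M α : MvPowerSeries ℕ ℂ) = _
  rw [coeff_M]
  simp [eq_comm]

theorem mul_mem_homogeneous {p q : ℕ} {f g : QSym} (hf : f ∈ homogeneous p)
    (hg : g ∈ homogeneous q) : f * g ∈ homogeneous (p + q) := by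
  rw [mem_homogeneous_iff] at *
  intro α hα
  obtain ⟨m, rfl⟩ := exists_expsList α
  rw [← coeff_eq_coeffM]
  show MvPowerSeries.coeff m ((f : MvPowerSeries ℕ ℂ) * (g : MvPowerSeries ℕ ℂ)) = _
  classical
  rw [MvPowerSeries.coeff_mul]
  refine Finset.sum_eq_zero fun x hx => ?_
  rw [coeff_eq_coeffM, coeff_eq_coeffM]
  by_cases h : size (expsList x.1) = p
  · rw [hg (expsList x.2), mul_zero]
    rintro rfl
    apply hα
    rw [← Finset.HasAntidiagonal.mem_antidiagonal.1 hx, size_expsList, map_add, ← h, size_expsList, size_expsList]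
  · rw [hf _ h, zero_mul]

theorem expsList_single (k : ℕ+) : expsList (Finsupp.single 0 (k : ℕ) : ℕ →₀ ℕ) = [k] := by
  have hs : (Finsupp.single 0 (k : ℕ) : ℕ →₀ ℕ).support = {0} := by
    simp
  rw [expsList, hs, Finset.sort_singleton]
  simp

/-- With only the first variable left, `M_α` becomes `x ^ |α|` if `α` has at most one part and `0`
otherwise; then evaluate at `1`. -/
theorem zeta_M (α : List ℕ+) : zeta (M α) = if α.length ≤ 1 then 1 else 0 := by
  have h : ∀ k, MvPowerSeries.coeff (Finsupp.single 0 k) (M α : MvPowerSeries ℕ ℂ) =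
      (if α.length ≤ 1 then Polynomial.X ^ size α else 0 : Polynomial ℂ).coeff k := by
    intro k
    rw [coeff_M]
    obtain rfl | ⟨k, rfl⟩ : k = 0 ∨ ∃ j : ℕ+, k = j :=
      k.eq_zero_or_pos.imp id fun h => ⟨⟨k, h⟩, rfl⟩
    · rw [Finsupp.single_zero, expsList_zero]
      rcases α with _ | ⟨a, _ | ⟨b, α⟩⟩
      · simp [size_nil]
      · simp [size_cons, size_nil, Polynomial.coeff_X_pow, a.pos.ne]
      · simp
    · rw [expsList_single]
      rcases α with _ | ⟨a, _ | ⟨b, α⟩⟩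
      · simp [size_nil, Polynomial.coeff_one]
      · simp [size_cons, size_nil, Polynomial.coeff_X_pow]
      · simp
  show zetaFun (M α) = _
  rw [zetaFun_eq _ _ h]
  split_ifs <;> simp

/-- Among the `M_α` of positive degree `n`, both `ζ` and the coefficient at `M_n` select the
one-part composition. This is the bridge between characters and cofreeness. -/
theorem coeffM_singleton_of_mem (b : ℕ+) {n : ℕ} {f : QSym} (hf : f ∈ homogeneous n) :
    coeffM [b] f = if n = b then zeta f else 0 := by
  suffices h : homogeneous n ≤ LinearMap.eqLocus (coeffM [b]).ofConv
      (if n = b then zeta.toLinearMap else 0) by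
    have := h hf
    rw [LinearMap.mem_eqLocus] at this
    rw [this]
    split_ifs <;> rfl
  refine Submodule.span_le.2 ?_
  rintro _ ⟨α, rfl, rfl⟩
  show coeffM [b] (M α) = _
  have hb := b.pos
  split_ifs with h
  · rw [AlgHom.toLinearMap_apply, zeta_M, coeffM_M]
    rcases α with _ | ⟨a, _ | ⟨c, α⟩⟩
    · simp only [size_nil] at h
      omega
    · simp only [size_cons, size_nil, add_zero] at h
      obtain rfl := PNat.coe_injective h
      simp
    · simp
  · rw [coeffM_M, if_neg]
    · rfl
    · rintro rfl
      exact h (by simp [size_cons, size_nil])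

/-! ### Existence and uniqueness of the theta map -/

/-- The linear automorphism `(-1)^n` on `QSym_n`. -/
def signMap : QSym →ₗ[ℂ] QSym := basisM.constr ℂ fun α => (-1 : ℂ) ^ size α • M α

theorem signMap_M (α : List ℕ+) : signMap (M α) = (-1 : ℂ) ^ size α • M α := by
  have h := basisM.constr_basis ℂ (fun α : List ℕ+ => (-1 : ℂ) ^ size α • M α) α
  rwa [basisM_apply] at h

theorem signMap_of_mem {n : ℕ} {f : QSym} (hf : f ∈ homogeneous n) :
    signMap f = (-1 : ℂ) ^ n • f := by
  suffices h : homogeneous n ≤ LinearMap.eqLocus signMap ((-1 : ℂ) ^ n • LinearMap.id) from h hf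
  refine Submodule.span_le.2 ?_
  rintro _ ⟨α, rfl, rfl⟩
  exact signMap_M α

theorem eq_of_eq_on_M_mul {V : Type*} [AddCommGroup V] [Module ℂ V] {F G : QSym →ₗ[ℂ] QSym →ₗ[ℂ] V}
    (h : ∀ α β, F (M α) (M β) = G (M α) (M β)) : F = G :=
  basisM.ext fun α => basisM.ext fun β => by simpa using h α β

theorem signMap_mul (f g : QSym) : signMap (f * g) = signMap f * signMap g := by
  suffices h : (LinearMap.mul ℂ QSym).compr₂ signMap =
      (LinearMap.mul ℂ QSym).compl₁₂ signMap signMap from LinearMap.congr_fun₂ h f g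
  refine eq_of_eq_on_M_mul fun α β => ?_
  simp only [LinearMap.compr₂_apply, LinearMap.compl₁₂_apply, LinearMap.mul_apply']
  rw [signMap_of_mem (mul_mem_homogeneous (M_mem_homogeneous α) (M_mem_homogeneous β)),
    signMap_M, signMap_M, smul_mul_smul_comm, pow_add]

theorem signMap_one : signMap 1 = 1 := by
  rw [← M_nil, signMap_M]
  simp [size_nil]

/-- `signMap` as an algebra map. -/
def signHom : QSym →ₐ[ℂ] QSym := AlgHom.ofLinearMap signMap signMap_one signMap_mul

theorem bar_eq (χ : QSym →ₗ[ℂ] ℂ) : bar χ = χ ∘ₗ signMap := by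
  refine basisM.ext fun α => ?_
  rw [bar, Module.Basis.constr_basis, LinearMap.comp_apply, basisM_apply, signMap_M, map_smul,
    smul_eq_mul]

/-- `thetaCharacter` as an algebra map. -/
def thetaHom : QSym →ₐ[ℂ] ℂ :=
  -- Since `QSym` is commutative, its antipode is an algebra map and a convolution product of
  -- characters is a character.
  (toConv ((zeta.comp (HopfAlgebra.antipodeAlgHom ℂ QSym)).comp signHom) * toConv zeta).ofConv

theorem thetaHom_apply (f : QSym) : thetaHom f = thetaCharacter f := by
  rw [thetaCharacter, bar_eq]
  rfl

/-- The coalgebra map induced by `thetaCharacter`. -/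
def thetaCoalgHom : QSym →ₗc[ℂ] QSym := cofree fun α => thetaHom (M α)

theorem coeffM_singleton_thetaCoalgHom (b : ℕ+) {n : ℕ} {f : QSym} (hf : f ∈ homogeneous n) :
    coeffM [b] (thetaCoalgHom f) = if n = b then thetaHom f else 0 := by
  suffices h : homogeneous n ≤ LinearMap.eqLocus ((coeffM [b]).ofConv ∘ₗ thetaCoalgHom.toLinearMap)
      (if n = b then thetaHom.toLinearMap else 0) by
    have := h hf
    rw [LinearMap.mem_eqLocus] at this
    refine this.trans ?_
    split_ifs <;> rfl
  refine Submodule.span_le.2 ?_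
  rintro _ ⟨α, rfl, rfl⟩
  show coeffM [b] (thetaCoalgHom (M α)) = _
  rw [thetaCoalgHom, coeffM_singleton_cofree]
  split_ifs <;> rfl

theorem thetaCoalgHom_mem {n : ℕ} {f : QSym} (hf : f ∈ homogeneous n) :
    thetaCoalgHom f ∈ homogeneous n := cofree_mem_homogeneous _ n hf

theorem thetaCoalgHom_one : thetaCoalgHom 1 = 1 := by
  refine ext_coeffM fun β => ?_
  rw [thetaCoalgHom, coeffM_cofree]
  rcases β with _ | ⟨b, β⟩
  · rw [components_nil, coeffM_nil]
  · rw [← M_nil, coeffM_M, if_neg (by simp), components_M_eq_zero]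
    have := b.pos
    rw [size_cons, size_nil]
    omega

theorem zeta_thetaCoalgHom (f : QSym) : zeta (thetaCoalgHom f) = thetaHom f := by
  suffices h : zeta.toLinearMap ∘ₗ thetaCoalgHom.toLinearMap = thetaHom.toLinearMap from
    LinearMap.congr_fun h f
  refine basisM.ext fun α => ?_
  rw [basisM_apply]
  show zeta (thetaCoalgHom (M α)) = thetaHom (M α)
  by_cases hα : α = []
  · subst hα
    rw [M_nil, thetaCoalgHom_one, map_one, map_one]
  · have hpos : 0 < size α := Nat.pos_of_ne_zero (mt size_eq_zero.1 hα)
    -- Here `ζ` is the coefficient at the composition with single part `|α|`; it exists only for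
    -- `|α| > 0`, whence the separate case `α = []`.
    have h := coeffM_singleton_of_mem ⟨size α, hpos⟩ (thetaCoalgHom_mem (M_mem_homogeneous α))
    rw [coeffM_singleton_thetaCoalgHom ⟨size α, hpos⟩ (M_mem_homogeneous α)] at h
    simpa using h.symm

/-- Multiplication of a bialgebra is a coalgebra map, so both sides are coalgebra maps on `QSym ⊗
QSym`. Cofreeness leaves the coefficients at `M_b`, where the identity is multiplicativity of `ζ`
and `thetaHom`. -/
theorem thetaCoalgHom_mul (f g : QSym) :
    thetaCoalgHom (f * g) = thetaCoalgHom f * thetaCoalgHom g := by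
  let F : QSym ⊗[ℂ] QSym →ₗc[ℂ] QSym := thetaCoalgHom.comp (Bialgebra.mulCoalgHom ℂ QSym)
  let G : QSym ⊗[ℂ] QSym →ₗc[ℂ] QSym := (Bialgebra.mulCoalgHom ℂ QSym).comp
    (Coalgebra.TensorProduct.map thetaCoalgHom thetaCoalgHom)
  suffices h : F = G from DFunLike.congr_fun h (f ⊗ₜ g)
  refine coalgHom_ext (C := QSym ⊗[ℂ] QSym) (F := F) (G := G) fun b x => ?_
  suffices h : (LinearMap.mul ℂ QSym).compr₂ ((coeffM [b]).ofConv ∘ₗ thetaCoalgHom.toLinearMap) =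
      ((LinearMap.mul ℂ QSym).compl₁₂ thetaCoalgHom.toLinearMap
        thetaCoalgHom.toLinearMap).compr₂ (coeffM [b]).ofConv by
    induction x with
    | zero => simp only [map_zero]
    | add x y hx hy => simp only [map_add, hx, hy]
    | tmul f g => exact LinearMap.congr_fun₂ h f g
  refine eq_of_eq_on_M_mul fun α β => ?_
  show coeffM [b] (thetaCoalgHom (M α * M β)) =
    coeffM [b] (thetaCoalgHom (M α) * thetaCoalgHom (M β))
  have hα := M_mem_homogeneous α
  have hβ := M_mem_homogeneous β
  rw [coeffM_singleton_thetaCoalgHom b (mul_mem_homogeneous hα hβ),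
    coeffM_singleton_of_mem b (mul_mem_homogeneous (thetaCoalgHom_mem hα) (thetaCoalgHom_mem hβ)),
    map_mul, map_mul, zeta_thetaCoalgHom, zeta_thetaCoalgHom]

/-- The theta map of `QSym`. -/
def theta : QSym →ₐc[ℂ] QSym where
  __ := thetaCoalgHom
  map_one' := thetaCoalgHom_one
  map_mul' := thetaCoalgHom_mul

theorem theta_apply (f : QSym) : theta f = thetaCoalgHom f := rfl

theorem isThetaMap_theta : IsThetaMap theta where
  graded _ _ hf := thetaCoalgHom_mem hf
  character f := by rw [theta_apply, zeta_thetaCoalgHom, thetaHom_apply]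

/-- Gradedness and the condition on `ζ` already fix every coefficient at `M_b`. -/
theorem IsThetaMap.eq_theta {Ψ : QSym →ₐc[ℂ] QSym} (hΨ : IsThetaMap Ψ) : Ψ = theta := by
  suffices h : (Ψ : QSym →ₗc[ℂ] QSym) = thetaCoalgHom by
    apply DFunLike.ext
    intro f
    exact DFunLike.congr_fun h f
  refine coalgHom_ext fun b f => ?_
  suffices h : (coeffM [b]).ofConv ∘ₗ (Ψ : QSym →ₗc[ℂ] QSym).toLinearMap =
      (coeffM [b]).ofConv ∘ₗ thetaCoalgHom.toLinearMap from LinearMap.congr_fun h f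
  refine basisM.ext fun α => ?_
  rw [basisM_apply]
  show coeffM [b] (Ψ (M α)) = coeffM [b] (thetaCoalgHom (M α))
  rw [coeffM_singleton_of_mem b (hΨ.graded _ _ (M_mem_homogeneous α)), hΨ.character,
    coeffM_singleton_thetaCoalgHom b (M_mem_homogeneous α), thetaHom_apply]

/-! ### Refinement and the odd-min composition, one part of `β` at a time -/

theorem append_inj_of_size {γ δ γ' δ' : List ℕ+} (h : γ ++ δ = γ' ++ δ')
    (hs : size γ = size γ') : γ = γ' ∧ δ = δ' := by
  rcases List.append_eq_append_iff.1 h with ⟨ε, rfl, rfl⟩ | ⟨ε, rfl, rfl⟩ <;>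
  · rw [size_append] at hs
    obtain rfl : ε = [] := size_eq_zero.1 (by omega)
    simp

theorem mem_partialSums {α : List ℕ+} {x : ℕ} :
    x ∈ partialSums α ↔ ∃ γ δ, γ ≠ [] ∧ δ ≠ [] ∧ α = γ ++ δ ∧ size γ = x := by
  simp only [partialSums, Finset.mem_image, Finset.mem_Ioo, psum]
  constructor
  · rintro ⟨i, ⟨h0, h1⟩, rfl⟩
    refine ⟨α.take i, α.drop i, ?_, ?_, (List.take_append_drop i α).symm, rfl⟩
    · rw [← List.length_pos_iff, List.length_take]
      omega
    · rw [← List.length_pos_iff, List.length_drop]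
      omega
  · rintro ⟨γ, δ, hγ, hδ, rfl, rfl⟩
    rw [← List.length_pos_iff] at hγ hδ
    refine ⟨γ.length, ⟨hγ, ?_⟩, ?_⟩
    · rw [List.length_append]
      omega
    · rw [List.take_left]

theorem size_pos {α : List ℕ+} (h : α ≠ []) : 0 < size α :=
  Nat.pos_of_ne_zero (mt size_eq_zero.1 h)

theorem bounds_of_mem_partialSums {α : List ℕ+} {x : ℕ} (h : x ∈ partialSums α) :
    0 < x ∧ x < size α := by
  obtain ⟨γ, δ, hγ, hδ, rfl, rfl⟩ := mem_partialSums.1 h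
  have := size_pos hδ
  rw [size_append]
  exact ⟨size_pos hγ, by omega⟩

theorem mem_partialSums_append {α β : List ℕ+} (hα : α ≠ []) {x : ℕ} :
    x ∈ partialSums (α ++ β) ↔ x ∈ partialSums α ∨ (x = size α ∧ β ≠ []) ∨
      ∃ y ∈ partialSums β, x = size α + y := by
  simp only [mem_partialSums]
  constructor
  · rintro ⟨γ, δ, hγ, hδ, h, rfl⟩
    rcases List.append_eq_append_iff.1 h with ⟨ε, rfl, rfl⟩ | ⟨ε, rfl, rfl⟩
    · by_cases hε : ε = []
      · subst hε
        exact Or.inr (Or.inl ⟨by simp, by simpa using hδ⟩)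
      · exact Or.inr (Or.inr ⟨_, ⟨ε, δ, hε, hδ, rfl, rfl⟩, size_append _ _⟩)
    · by_cases hε : ε = []
      · subst hε
        exact Or.inr (Or.inl ⟨by simp, by simpa using hδ⟩)
      · exact Or.inl ⟨γ, ε, hγ, hε, rfl, rfl⟩
  · rintro (⟨γ, δ, hγ, hδ, rfl, rfl⟩ | ⟨rfl, h⟩ | ⟨_, ⟨γ, δ, hγ, hδ, rfl, rfl⟩, rfl⟩)
    · exact ⟨γ, δ ++ β, hγ, by simp [hδ], by simp, rfl⟩
    · exact ⟨α, β, hα, h, rfl, rfl⟩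
    · exact ⟨α ++ γ, δ, by simp [hα], hδ, by simp, size_append _ _⟩

theorem partialSums_singleton (b : ℕ+) : partialSums [b] = ∅ := by
  have h : (Finset.Ioo 0 1 : Finset ℕ) = ∅ := rfl
  simp [partialSums, h]

theorem mem_partialSums_cons {b : ℕ+} {β : List ℕ+} {x : ℕ} :
    x ∈ partialSums (b :: β) ↔ (x = b ∧ β ≠ []) ∨ ∃ y ∈ partialSums β, x = b + y := by
  have h := mem_partialSums_append (α := [b]) (β := β) (by simp) (x := x)
  simpa [partialSums_singleton, size_cons, size_nil] using h

/-- Partial sums below `b` do not occur in `b :: β`, `b` itself is a cut of `α ++ α'`, and the later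
ones are those of `β` and `α'` shifted by `b`. -/
theorem coarsens_cons_append {b : ℕ+} {α α' β : List ℕ+} (h : size α = b) :
    Coarsens (b :: β) (α ++ α') ↔ Coarsens β α' := by
  have hα : α ≠ [] := by
    rintro rfl
    exact b.pos.ne h
  unfold Coarsens
  rw [size_cons, size_append, h, Nat.add_left_cancel_iff]
  refine and_congr_right fun hs => ⟨fun hsub y hy => ?_, fun hsub x hx => ?_⟩
  · have h1 := hsub (mem_partialSums_cons.2 (Or.inr ⟨y, hy, rfl⟩))
    have h2 := (bounds_of_mem_partialSums hy).1
    rcases (mem_partialSums_append hα).1 h1 with h3 | ⟨h3, _⟩ | ⟨z, hz, h3⟩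
    · have := (bounds_of_mem_partialSums h3).2
      omega
    · omega
    · obtain rfl : y = z := by omega
      exact hz
  · rw [mem_partialSums_append hα, h]
    rcases mem_partialSums_cons.1 hx with ⟨rfl, hβ⟩ | ⟨y, hy, rfl⟩
    · refine Or.inr (Or.inl ⟨rfl, ?_⟩)
      rintro rfl
      exact hβ (size_eq_zero.1 hs)
    · exact Or.inr (Or.inr ⟨y, hsub hy, rfl⟩)

theorem Coarsens.exists_append {b : ℕ+} {α β : List ℕ+} (h : Coarsens (b :: β) α) :
    ∃ γ δ, α = γ ++ δ ∧ size γ = b := by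
  by_cases hβ : β = []
  · subst hβ
    exact ⟨α, [], by simp, by simpa [size_cons, size_nil] using h.1.symm⟩
  · obtain ⟨γ, δ, _, _, h1, h2⟩ :=
      mem_partialSums.1 (h.2 (mem_partialSums_cons.2 (Or.inl ⟨rfl, hβ⟩)))
    exact ⟨γ, δ, h1, h2⟩

theorem size_map_size {B : List (List ℕ+)} (h : [] ∉ B) :
    size (B.map fun block => (size block).toPNat') = size B.flatten := by
  induction B with
  | nil => rfl
  | cons b B ih =>
    simp only [List.mem_cons, not_or] at h
    rw [List.map_cons, size_cons, ih h.2, List.flatten_cons, size_append, Nat.toPNat'_coe,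
      if_pos (size_pos (Ne.symm h.1))]

theorem size_oddMin (α : List ℕ+) : size (oddMin α) = size α := by
  rw [oddMin, size_map_size (List.nil_notMem_splitBy _ _), List.flatten_splitBy]

/-- The boundaries between the blocks of `splitBy` are exactly the places where an odd part is
followed by an even one. -/
theorem mem_partialSums_oddMin {α : List ℕ+} {x : ℕ} :
    x ∈ partialSums (oddMin α) ↔ ∃ γ δ, ∃ a b : ℕ+, α = γ ++ a :: b :: δ ∧
      Odd (a : ℕ) ∧ Even (b : ℕ) ∧ size γ + a = x := by
  rw [mem_partialSums]
  constructor
  · rintro ⟨γ, δ, hγ, hδ, h, rfl⟩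
    obtain ⟨B, B', hB, rfl, rfl⟩ := List.map_eq_append_iff.1 h
    have hB1 : B ≠ [] := by simpa using hγ
    have hB2 : B' ≠ [] := by simpa using hδ
    -- The cut lies between the last block `u` on the left and the first block `v` on the right; the
    -- last part of `u` and the first of `v` are the odd-even pair.
    obtain ⟨B, u, rfl⟩ := List.eq_nil_or_concat' B |>.resolve_left hB1
    obtain ⟨v, B', rfl⟩ := List.exists_cons_of_ne_nil hB2
    have hn := List.nil_notMem_splitBy
      (fun a b : ℕ+ => !(decide (Odd (a : ℕ)) && decide (Even (b : ℕ)))) α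
    have hc := List.isChain_getLast_head_splitBy
      (fun a b : ℕ+ => !(decide (Odd (a : ℕ)) && decide (Even (b : ℕ)))) α
    have hf := List.flatten_splitBy
      (fun a b : ℕ+ => !(decide (Odd (a : ℕ)) && decide (Even (b : ℕ)))) α
    rw [hB] at hn hc hf
    rw [List.append_assoc, List.singleton_append, List.isChain_append_cons_cons] at hc
    obtain ⟨-, ⟨hu, hv, hr⟩, -⟩ := hc
    obtain ⟨u, a, rfl⟩ := List.eq_nil_or_concat' u |>.resolve_left hu
    obtain ⟨b, v, rfl⟩ := List.exists_cons_of_ne_nil hv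
    simp only [List.getLast_append_singleton, List.head_cons, Bool.not_eq_false',
      Bool.and_eq_true] at hr
    replace hr := And.intro (of_decide_eq_true hr.1) (of_decide_eq_true hr.2)
    refine ⟨B.flatten ++ u, v ++ B'.flatten, a, b, ?_, hr.1, hr.2, ?_⟩
    · rw [← hf]
      simp
    · rw [size_map_size]
      · simp [size_append, size_cons, size_nil, add_assoc]
      · exact fun h => hn (List.mem_append_left _ h)
  · rintro ⟨γ, δ, a, b, rfl, ha, hb, rfl⟩
    have h : oddMin (γ ++ a :: b :: δ) = oddMin (γ ++ [a]) ++ oddMin (b :: δ) := by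
      have h1 : γ ++ a :: b :: δ = (γ ++ [a]) ++ b :: δ := by simp
      rw [oddMin, h1, List.splitBy_append_cons, List.map_append]
      · rfl
      · simp [ha, hb]
    refine ⟨oddMin (γ ++ [a]), oddMin (b :: δ), ?_, ?_, h, ?_⟩
    · simp [oddMin]
    · simp [oddMin]
    · simp [size_oddMin, size_append, size_cons, size_nil]

/-- No odd part is immediately followed by an even part. -/
def DropFree (α : List ℕ+) : Prop :=
  ∀ (γ δ : List ℕ+) (a b : ℕ+), α = γ ++ a :: b :: δ → ¬(Odd (a : ℕ) ∧ Even (b : ℕ))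

/-- Every odd-even cut of `α ++ α'` must be a partial sum of `b :: β`. A cut inside `α` lies
strictly between `0` and `b`, so it is forbidden; one at the junction is `b` itself and costs
nothing; those inside `α'` give the condition on `β`. -/
theorem coarsens_oddMin_append {b : ℕ+} {α α' β : List ℕ+} (h : size α = b) :
    Coarsens (oddMin (α ++ α')) (b :: β) ↔ DropFree α ∧ Coarsens (oddMin α') β := by
  unfold Coarsens
  rw [size_cons, size_oddMin, size_oddMin, size_append, h, Nat.add_left_cancel_iff,
    and_left_comm]
  refine and_congr_right fun hs => ⟨fun hsub => ⟨?_, fun y hy => ?_⟩, ?_⟩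
  · rintro γ δ c d rfl ⟨hc, hd⟩
    have h1 := hsub (mem_partialSums_oddMin.2
      ⟨γ, δ ++ α', c, d, by simp, hc, hd, rfl⟩)
    have hd' := d.pos
    simp only [size_append, size_cons] at h
    rcases mem_partialSums_cons.1 h1 with ⟨h2, _⟩ | ⟨y, hy, h2⟩ <;> omega
  · obtain ⟨γ, δ, c, d, rfl, hc, hd, rfl⟩ := mem_partialSums_oddMin.1 hy
    have h1 := hsub (mem_partialSums_oddMin.2
      ⟨α ++ γ, δ, c, d, by simp, hc, hd, rfl⟩)
    have hc' := c.pos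
    rw [size_append, h] at h1
    rcases mem_partialSums_cons.1 h1 with ⟨h2, _⟩ | ⟨y, hy, h2⟩
    · omega
    · obtain rfl : size γ + c = y := by omega
      exact hy
  · rintro ⟨hfree, hsub⟩ x hx
    obtain ⟨γ, δ, c, d, heq, hc, hd, rfl⟩ := mem_partialSums_oddMin.1 hx
    rw [mem_partialSums_cons]
    rcases List.append_eq_append_iff.1 heq with ⟨ε, rfl, rfl⟩ | ⟨ε, rfl, h2⟩
    · refine Or.inr ⟨size ε + c, hsub (mem_partialSums_oddMin.2
        ⟨ε, δ, c, d, rfl, hc, hd, rfl⟩), ?_⟩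
      rw [size_append, h, add_assoc]
    · rcases ε with _ | ⟨e, _ | ⟨f, ε⟩⟩
      · rw [List.append_nil] at h
        refine Or.inr ⟨size [] + c, hsub (mem_partialSums_oddMin.2
          ⟨[], δ, c, d, by simpa using h2.symm, hc, hd, rfl⟩), ?_⟩
        rw [h, size_nil, zero_add]
      · simp only [List.cons_append, List.nil_append, List.cons.injEq] at h2
        obtain ⟨rfl, rfl⟩ := h2
        refine Or.inl ⟨by simpa [size_append, size_cons, size_nil] using h, ?_⟩
        rintro rfl
        have := d.pos
        simp only [size_cons, size_nil] at hs
        omega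
      · simp only [List.cons_append, List.cons.injEq] at h2
        obtain ⟨rfl, rfl, -⟩ := h2
        exact absurd ⟨hc, hd⟩ (hfree γ ε c d rfl)

/-! ### Factoring the shuffle coefficient -/

open Classical in
/-- The number of parts of `α` with the property `p` whose starting point satisfies `P`. -/
def countParts (p P : ℕ → Prop) (α : List ℕ+) : ℕ :=
  (Finset.univ.filter (fun j : Fin α.length => p (α.get j : ℕ) ∧ P (psum α j))).card

open Classical in
theorem countParts_cons (p P : ℕ → Prop) (a : ℕ+) (α : List ℕ+) :
    countParts p P (a :: α) =
      (if p a ∧ P 0 then 1 else 0) + countParts p (fun x => P (a + x)) α := by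
  unfold countParts
  rw [Finset.card_filter, Finset.card_filter]
  refine (Fin.sum_univ_succ _).trans ?_
  congr 1

theorem countParts_append (p P : ℕ → Prop) (α β : List ℕ+) :
    countParts p P (α ++ β) =
      countParts p P α + countParts p (fun x => P (size α + x)) β := by
  induction α generalizing P with
  | nil => simp only [size_nil, zero_add, List.nil_append]; simp [countParts]
  | cons a α ih =>
    rw [List.cons_append, countParts_cons, countParts_cons, ih, add_assoc]
    simp only [size_cons, add_assoc]

theorem countParts_eq_zero {p P : ℕ → Prop} {α : List ℕ+} (h : ∀ x < size α, ¬P x) :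
    countParts p P α = 0 := by
  induction α generalizing P with
  | nil => simp [countParts]
  | cons a α ih =>
    rw [size_cons] at h
    have ha := a.pos
    rw [countParts_cons, ih fun x hx => h _ (by omega), if_neg]
    exact fun hp => h 0 (by omega) hp.2

open Classical in
theorem countParts_eq_countP {p P : ℕ → Prop} {α : List ℕ+} (h : ∀ x < size α, P x) :
    countParts p P α = α.countP fun a : ℕ+ => p (a : ℕ) := by
  induction α generalizing P with
  | nil => simp [countParts]
  | cons a α ih =>
    rw [size_cons] at h
    have ha := a.pos
    rw [countParts_cons, ih fun x hx => h _ (by omega), List.countP_cons, add_comm]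
    simp [h 0 (by omega)]

theorem countParts_append_zero (p : ℕ → Prop) {b : ℕ+} {α α' β : List ℕ+} (h : size α = b) :
    countParts p (fun x => psum (b :: β) 0 ≤ x ∧ x < psum (b :: β) (0 + 1)) (α ++ α') =
      countParts p (fun _ => True) α := by
  classical
  have h1 : psum (b :: β) 0 = 0 := rfl
  have h2 : psum (b :: β) (0 + 1) = b := by simp [psum, size_cons, size_nil]
  simp only [h1, h2]
  rw [countParts_append, countParts_eq_countP (α := α), countParts_eq_countP (α := α),
    countParts_eq_zero, add_zero]
  · intro x _
    omega
  · simp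
  · intro x hx
    omega

theorem countParts_append_succ (p : ℕ → Prop) {b : ℕ+} {α α' β : List ℕ+} (h : size α = b)
    (i : ℕ) :
    countParts p (fun x => psum (b :: β) (i + 1) ≤ x ∧ x < psum (b :: β) (i + 1 + 1)) (α ++ α') =
      countParts p (fun x => psum β i ≤ x ∧ x < psum β (i + 1)) α' := by
  have h1 : ∀ i, psum (b :: β) (i + 1) = b + psum β i := by simp [psum, size_cons]
  simp only [h1]
  rw [countParts_append, countParts_eq_zero, zero_add]
  · simp only [h, Nat.add_le_add_iff_left, Nat.add_lt_add_iff_left]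
  · intro x hx
    omega

theorem oddParts_eq (α β : List ℕ+) (i : ℕ) : oddParts α β i =
    countParts Odd (fun x => psum β i ≤ x ∧ x < psum β (i + 1)) α := by
  unfold oddParts countParts
  congr

theorem evenParts_eq (α β : List ℕ+) (i : ℕ) : evenParts α β i =
    countParts Even (fun x => psum β i ≤ x ∧ x < psum β (i + 1)) α := by
  unfold evenParts countParts
  congr

/-- `1 / (O! E!)`, where `O` and `E` are the numbers of odd and even parts. -/
def parityCoeff (α : List ℕ+) : ℂ :=
  1 / (((countParts Odd (fun _ => True) α).factorial : ℂ) *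
    ((countParts Even (fun _ => True) α).factorial : ℂ))

/-- The first window `[0, b)` contains exactly the starting points of the parts of `α`; the other
windows are those of `β`, shifted by `b`. -/
theorem shuffleCoeff_cons_append {b : ℕ+} {α α' β : List ℕ+} (h : size α = b) :
    shuffleCoeff (α ++ α') (b :: β) = parityCoeff α * shuffleCoeff α' β := by
  unfold shuffleCoeff
  rw [List.length_cons, Finset.prod_range_succ', mul_comm]
  simp only [oddParts_eq, evenParts_eq, countParts_append_zero _ h, countParts_append_succ _ h]
  rfl

/-! ### Shuffle functions as images under a coalgebra endomorphism -/

open Classical in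
/-- The coefficient of `M_n` in `S_α`, `|α| = n`. -/
def shuffleWeight (α : List ℕ+) : ℂ := if DropFree α then parityCoeff α else 0

/-- Since parts are positive, only one prefix has size `b`, so a single cut contributes to the
convolution. -/
theorem conv_component (t : List ℕ+ → ℂ) (b : ℕ+) (g : WithConv (QSym →ₗ[ℂ] ℂ))
    {α α' : List ℕ+} (h : size α = b) :
    (component t b * g) (M (α ++ α')) = t α * g (M α') := by
  rw [conv_M, Finset.sum_eq_single α.length]
  · rw [List.take_left, List.drop_left, component_M, if_pos h]
  · intro i hi hne
    rw [component_M, if_neg, zero_mul]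
    intro hs
    apply hne
    have := (append_inj_of_size (List.take_append_drop i (α ++ α')) (hs.trans h.symm)).1
    rw [← this, List.length_take]
    rw [Finset.mem_range] at hi
    omega
  · simp

theorem conv_component_eq_zero (t : List ℕ+ → ℂ) (b : ℕ+) (g : WithConv (QSym →ₗ[ℂ] ℂ))
    {α : List ℕ+} (h : ¬∃ γ δ, α = γ ++ δ ∧ size γ = b) :
    (component t b * g) (M α) = 0 := by
  rw [conv_M]
  refine Finset.sum_eq_zero fun i _ => ?_
  rw [component_M, if_neg, zero_mul]
  exact fun hs => h ⟨α.take i, α.drop i, (List.take_append_drop i α).symm, hs⟩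

open Classical in
-- Both sides obey the same recursion on the first part of `β`: split off the prefix of `α` of size
-- `b`, with both sides zero if there is none.
theorem components_shuffleWeight (α β : List ℕ+) :
    components shuffleWeight β (M α) =
      if Coarsens (oddMin α) β ∧ Coarsens β α then shuffleCoeff α β else 0 := by
  induction β generalizing α with
  | nil =>
    rw [components_nil, one_M]
    by_cases hα : α = []
    · subst hα
      have h : Coarsens [] [] := ⟨rfl, subset_rfl⟩
      rw [if_pos rfl, if_pos ⟨h, h⟩]
      simp [shuffleCoeff]
    · rw [if_neg hα, if_neg]
      rintro ⟨-, h, -⟩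
      exact hα (size_eq_zero.1 h.symm)
  | cons b β ih =>
    rw [components_cons]
    by_cases h : ∃ γ δ, α = γ ++ δ ∧ size γ = b
    · obtain ⟨γ, δ, rfl, hb⟩ := h
      rw [conv_component _ _ _ hb, ih, coarsens_oddMin_append hb, coarsens_cons_append hb,
        shuffleCoeff_cons_append hb, shuffleWeight]
      by_cases h1 : DropFree γ
      · simp [h1]
      · simp [h1]
    · rw [conv_component_eq_zero _ _ _ h, if_neg]
      exact fun hc => h hc.2.exists_append

theorem coeffM_S (α β : List ℕ+) : coeffM β (S α) = components shuffleWeight β (M α) := by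
  classical
  rw [components_shuffleWeight, S]
  have hs : ∀ (s : Finset (List ℕ+)) (g : List ℕ+ → QSym),
      coeffM β (∑ γ ∈ s, g γ) = ∑ γ ∈ s, coeffM β (g γ) := fun s g => map_sum (coeffM β).ofConv g s
  have hm : ∀ (c : ℂ) (g : QSym), coeffM β (c • g) = c * coeffM β g :=
    fun c g => map_smul (coeffM β).ofConv c g
  simp only [hs, hm, coeffM_M, mul_ite, mul_one, mul_zero, Finset.sum_ite_eq']
  refine if_congr ?_ rfl rfl
  simp only [Finset.mem_filter, Set.Finite.mem_toFinset, Set.mem_ofPred_eq]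
  exact ⟨fun h => h.2, fun h => ⟨h.2.1, h⟩⟩

/-- The change of basis `M_α ↦ S_α`, as a coalgebra map. -/
def shuffleHom : QSym →ₗc[ℂ] QSym := cofree shuffleWeight

theorem shuffleHom_M (α : List ℕ+) : shuffleHom (M α) = S α :=
  ext_coeffM fun β => by rw [shuffleHom, coeffM_cofree, coeffM_S]

/-! ### Exponential functionals and the weight of the shuffle functions -/

open Classical in
/-- The functional `M_α ↦ c^ℓ / ℓ!` if all parts of `α` satisfy `p`, and `0` otherwise: the
exponential of `c` times the sum of the coordinates `M_b` with `p b`. -/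
def expOn (p : ℕ → Prop) (c : ℂ) : WithConv (QSym →ₗ[ℂ] ℂ) :=
  toConv (basisM.constr ℂ fun α =>
    if ∀ a ∈ α, p (a : ℕ) then c ^ α.length / (α.length.factorial : ℂ) else 0)

open Classical in
theorem expOn_M (p : ℕ → Prop) (c : ℂ) (α : List ℕ+) : expOn p c (M α) =
    if ∀ a ∈ α, p (a : ℕ) then c ^ α.length / (α.length.factorial : ℂ) else 0 := by
  show basisM.constr ℂ _ (M α) = _
  rw [← basisM_apply, Module.Basis.constr_basis]

theorem expOn_zero (p : ℕ → Prop) : expOn p 0 = 1 := by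
  refine functional_ext fun α => ?_
  rw [expOn_M, one_M]
  rcases α with _ | ⟨a, α⟩ <;> simp

/-- The binomial theorem: the cut after `i` parts contributes `c^i d^(ℓ-i) / (i! (ℓ-i)!)`. -/
theorem expOn_mul (p : ℕ → Prop) (c d : ℂ) : expOn p c * expOn p d = expOn p (c + d) := by
  refine functional_ext fun α => ?_
  rw [conv_M]
  simp only [expOn_M]
  by_cases h : ∀ a ∈ α, p (a : ℕ)
  · rw [if_pos h, add_pow, Finset.sum_div]
    refine Finset.sum_congr rfl fun i hi => ?_
    have hi' : i ≤ α.length := by simpa [Nat.lt_succ_iff] using hi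
    rw [if_pos fun a ha => h a (List.mem_of_mem_take ha),
      if_pos fun a ha => h a (List.mem_of_mem_drop ha), List.length_take, List.length_drop,
      min_eq_left hi', Nat.cast_choose ℂ hi']
    have h1 : (α.length.factorial : ℂ) ≠ 0 := Nat.cast_ne_zero.2 (Nat.factorial_ne_zero _)
    field_simp
  · rw [if_neg h]
    refine Finset.sum_eq_zero fun i _ => ?_
    by_cases h1 : ∀ a ∈ α.take i, p (a : ℕ)
    · rw [if_neg (c := ∀ a ∈ α.drop i, p (a : ℕ)), mul_zero]
      intro h2
      refine h fun a ha => ?_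
      rw [← List.take_append_drop i α, List.mem_append] at ha
      exact ha.elim (h1 a) (h2 a)
    · rw [if_neg h1, zero_mul]

/-- If no odd part is directly followed by an even one, then once an odd part occurs all later parts
are odd. -/
theorem dropFree_iff {α : List ℕ+} : DropFree α ↔
    ∃ γ δ, α = γ ++ δ ∧ (∀ a ∈ γ, Even (a : ℕ)) ∧ ∀ a ∈ δ, Odd (a : ℕ) := by
  constructor
  · intro h
    induction α with
    | nil => exact ⟨[], [], rfl, by simp, by simp⟩
    | cons a α ih =>
      obtain ⟨γ, δ, rfl, hγ, hδ⟩ := ih fun γ δ c d heq => h (a :: γ) δ c d (by simp [heq])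
      rcases Nat.even_or_odd a with ha | ha
      · exact ⟨a :: γ, δ, rfl, by simpa using ⟨ha, hγ⟩, hδ⟩
      · rcases γ with _ | ⟨c, γ⟩
        · exact ⟨[], a :: δ, rfl, by simp, by simpa using ⟨ha, hδ⟩⟩
        · exact absurd ⟨ha, hγ c (by simp)⟩ (h [] (γ ++ δ) a c rfl)
  · rintro ⟨γ, δ, rfl, hγ, hδ⟩ γ' δ' a b heq ⟨ha, hb⟩
    have hb' : b ∉ δ := fun h => Nat.not_odd_iff_even.2 hb (hδ b h)
    have ha' : a ∉ γ := fun h => Nat.not_odd_iff_even.2 (hγ a h) ha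
    rcases List.append_eq_append_iff.1 heq with ⟨ε, rfl, rfl⟩ | ⟨ε, rfl, h⟩
    · simp at hb'
    · rcases ε with _ | ⟨e, ε⟩
      · rw [List.nil_append] at h
        simp [← h] at hb'
      · simp only [List.cons_append, List.cons.injEq] at h
        simp [h.1] at ha'

theorem countParts_append_of_forall {p : ℕ → Prop} {γ δ : List ℕ+} (hγ : ∀ a ∈ γ, p (a : ℕ))
    (hδ : ∀ a ∈ δ, ¬p (a : ℕ)) : countParts p (fun _ => True) (γ ++ δ) = γ.length := by
  classical
  rw [countParts_append, countParts_eq_countP (by simp), countParts_eq_countP (by simp),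
    List.countP_eq_length.2 (by simpa using hγ), List.countP_eq_zero.2 (by simpa using hδ),
    add_zero]

theorem parityCoeff_append {γ δ : List ℕ+} (hγ : ∀ a ∈ γ, Even (a : ℕ))
    (hδ : ∀ a ∈ δ, Odd (a : ℕ)) : parityCoeff (γ ++ δ) =
      1 / ((δ.length.factorial : ℂ) * (γ.length.factorial : ℂ)) := by
  have h1 := countParts_append_of_forall hγ fun a ha => Nat.not_even_iff_odd.2 (hδ a ha)
  have h2 : countParts Odd (fun _ => True) (γ ++ δ) = δ.length := by
    have h3 := countParts_append_of_forall (γ := δ) (δ := []) hδ (by simp)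
    have h4 := countParts_append_of_forall (γ := []) (δ := γ) (p := Odd) (by simp)
      fun a ha => Nat.not_odd_iff_even.2 (hγ a ha)
    rw [List.append_nil] at h3
    rw [List.nil_append] at h4
    rw [countParts_append, h3, h4, List.length_nil, zero_add]
  rw [parityCoeff, h1, h2]

theorem append_inj_of_parity {γ δ γ' δ' : List ℕ+} (h : γ ++ δ = γ' ++ δ')
    (hγ : ∀ a ∈ γ, Even (a : ℕ)) (hδ : ∀ a ∈ δ, Odd (a : ℕ))
    (hγ' : ∀ a ∈ γ', Even (a : ℕ)) (hδ' : ∀ a ∈ δ', Odd (a : ℕ)) : γ.length = γ'.length := by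
  have h1 := countParts_append_of_forall hγ fun a ha => Nat.not_even_iff_odd.2 (hδ a ha)
  have h2 := countParts_append_of_forall hγ' fun a ha => Nat.not_even_iff_odd.2 (hδ' a ha)
  rw [← h1, h, h2]

/-- Only a cut with even parts before it and odd parts after it contributes; there is at most one,
and it exists exactly for drop-free `α`. -/
theorem expOn_even_mul_expOn_odd_M (α : List ℕ+) :
    (expOn Even 1 * expOn Odd 1) (M α) = shuffleWeight α := by
  rw [conv_M, shuffleWeight]
  simp only [expOn_M, one_pow]
  by_cases h : DropFree α
  · rw [if_pos h]
    obtain ⟨γ, δ, rfl, hγ, hδ⟩ := dropFree_iff.1 h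
    rw [Finset.sum_eq_single γ.length]
    · rw [List.take_left, List.drop_left, if_pos hγ, if_pos hδ, parityCoeff_append hγ hδ]
      field_simp
    · intro i hi hne
      by_cases h1 : ∀ a ∈ (γ ++ δ).take i, Even (a : ℕ)
      · rw [if_neg (c := ∀ a ∈ (γ ++ δ).drop i, Odd (a : ℕ)), mul_zero]
        intro h2
        apply hne
        have := append_inj_of_parity (List.take_append_drop i (γ ++ δ)) h1 h2 hγ hδ
        rw [List.length_take] at this
        rw [Finset.mem_range] at hi
        omega
      · rw [if_neg h1, zero_mul]
    · simp
  · rw [if_neg h]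
    refine Finset.sum_eq_zero fun i _ => ?_
    by_cases h1 : ∀ a ∈ α.take i, Even (a : ℕ)
    · rw [if_neg (c := ∀ a ∈ α.drop i, Odd (a : ℕ)), mul_zero]
      exact fun h2 => h (dropFree_iff.2
        ⟨α.take i, α.drop i, (List.take_append_drop i α).symm, h1, h2⟩)
    · rw [if_neg h1, zero_mul]

theorem shuffleWeight_of_isOdd {α : List ℕ+} (h : IsOdd α) :
    shuffleWeight α = 1 / (α.length.factorial : ℂ) := by
  have h1 : DropFree α := dropFree_iff.2 ⟨[], α, rfl, by simp, h⟩
  have h2 := parityCoeff_append (γ := []) (δ := α) (by simp) h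
  rw [shuffleWeight, if_pos h1]
  simpa using h2

theorem shuffleWeight_nil : shuffleWeight [] = 1 := by
  simpa using shuffleWeight_of_isOdd (α := []) (by simp [IsOdd])

theorem shuffleWeight_singleton (a : ℕ+) : shuffleWeight [a] = 1 := by
  have h1 : DropFree [a] := by
    intro γ δ c d h
    have := congrArg List.length h
    simp at this
    omega
  rcases Nat.even_or_odd a with ha | ha
  · have h2 := parityCoeff_append (γ := [a]) (δ := []) (by simpa using ha) (by simp)
    rw [shuffleWeight, if_pos h1]
    simpa using h2
  · simpa using shuffleWeight_of_isOdd (α := [a]) (by simpa [IsOdd] using ha)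

/-! ### Pulling the theta character back along `shuffleHom` -/

/-- The pullback of a functional along an endomorphism. -/
def pullback (F : QSym →ₗ[ℂ] QSym) (f : WithConv (QSym →ₗ[ℂ] ℂ)) : WithConv (QSym →ₗ[ℂ] ℂ) :=
  toConv (f.ofConv ∘ₗ F)

theorem pullback_apply (F : QSym →ₗ[ℂ] QSym) (f : WithConv (QSym →ₗ[ℂ] ℂ)) (x : QSym) :
    pullback F f x = f (F x) := rfl

theorem pullback_mul (F : QSym →ₗc[ℂ] QSym) (f g : WithConv (QSym →ₗ[ℂ] ℂ)) :
    pullback F.toLinearMap (f * g) = pullback F.toLinearMap f * pullback F.toLinearMap g := by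
  rw [pullback, LinearMap.convMul_comp_coalgHom_distrib]
  rfl

theorem pullback_one (F : QSym →ₗc[ℂ] QSym) : pullback F.toLinearMap 1 = 1 := by
  ext f
  show algebraMap ℂ ℂ (Coalgebra.counit (R := ℂ) (F f)) =
    algebraMap ℂ ℂ (Coalgebra.counit (R := ℂ) f)
  rw [CoalgHomClass.counit_comp_apply]

theorem pullback_signMap_M (f : WithConv (QSym →ₗ[ℂ] ℂ)) (α : List ℕ+) :
    pullback signMap f (M α) = (-1 : ℂ) ^ size α * f (M α) := by
  rw [pullback_apply, signMap_M]
  exact map_smul f.ofConv _ _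

theorem pullback_signMap_mul (f g : WithConv (QSym →ₗ[ℂ] ℂ)) :
    pullback signMap (f * g) = pullback signMap f * pullback signMap g := by
  refine functional_ext fun α => ?_
  rw [pullback_signMap_M, conv_M, conv_M, Finset.mul_sum]
  refine Finset.sum_congr rfl fun i _ => ?_
  rw [pullback_signMap_M, pullback_signMap_M, ← size_take_add_drop α i, pow_add]
  ring

theorem pullback_signMap_comm (t : List ℕ+ → ℂ) (f : WithConv (QSym →ₗ[ℂ] ℂ)) :
    pullback (cofree t).toLinearMap (pullback signMap f) =
      pullback signMap (pullback (cofree t).toLinearMap f) := by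
  refine functional_ext fun α => ?_
  rw [pullback_signMap_M]
  show f (signMap (cofree t (M α))) = _ * f (cofree t (M α))
  rw [signMap_of_mem (cofree_mem_homogeneous t _ (M_mem_homogeneous α))]
  exact map_smul f.ofConv _ _

theorem neg_one_pow_size_of_even {α : List ℕ+} (h : ∀ a ∈ α, Even (a : ℕ)) :
    (-1 : ℂ) ^ size α = 1 := by
  induction α with
  | nil => simp [size_nil]
  | cons a α ih =>
    rw [List.forall_mem_cons] at h
    rw [size_cons, pow_add, ih h.2, h.1.neg_one_pow, one_mul]

theorem neg_one_pow_size_of_odd {α : List ℕ+} (h : ∀ a ∈ α, Odd (a : ℕ)) :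
    (-1 : ℂ) ^ size α = (-1) ^ α.length := by
  induction α with
  | nil => simp [size_nil]
  | cons a α ih =>
    rw [List.forall_mem_cons] at h
    rw [size_cons, pow_add, ih h.2, h.1.neg_one_pow, List.length_cons, pow_succ, mul_comm]

theorem pullback_signMap_expOn_even (c : ℂ) :
    pullback signMap (expOn Even c) = expOn Even c := by
  refine functional_ext fun α => ?_
  rw [pullback_signMap_M, expOn_M]
  split_ifs with h
  · rw [neg_one_pow_size_of_even h, one_mul]
  · rw [mul_zero]

/-- For a composition with only odd parts, `|α|` and `ℓ(α)` have the same parity, so the sign is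
absorbed into `c ^ ℓ`. -/
theorem pullback_signMap_expOn_odd (c : ℂ) :
    pullback signMap (expOn Odd c) = expOn Odd (-c) := by
  refine functional_ext fun α => ?_
  rw [pullback_signMap_M, expOn_M, expOn_M]
  split_ifs with h
  · rw [neg_one_pow_size_of_odd h, neg_pow c, mul_div_assoc]
  · rw [mul_zero]

theorem pullback_shuffleHom_zeta :
    pullback shuffleHom.toLinearMap (toConv zeta.toLinearMap) = expOn Even 1 * expOn Odd 1 := by
  refine functional_ext fun α => ?_
  rw [expOn_even_mul_expOn_odd_M]
  show zeta (shuffleHom (M α)) = _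
  have hmem : shuffleHom (M α) ∈ homogeneous (size α) :=
    cofree_mem_homogeneous _ _ (M_mem_homogeneous α)
  by_cases hα : α = []
  · subst hα
    have h : shuffleHom (M []) = M [] := by
      refine ext_coeffM fun β => ?_
      rw [shuffleHom, coeffM_cofree, coeffM_M]
      by_cases hβ : β = []
      · subst hβ
        rw [components_nil, one_M]
      · rw [components_M_eq_zero, if_neg (Ne.symm hβ)]
        exact (size_pos hβ).ne'
    rw [h, M_nil, map_one, shuffleWeight_nil]
  · have h := coeffM_singleton_of_mem ⟨size α, size_pos hα⟩ hmem
    rw [shuffleHom, coeffM_singleton_cofree shuffleWeight ⟨size α, size_pos hα⟩] at h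
    have h1 : zeta (cofree shuffleWeight (M α)) = shuffleWeight α := by simpa using h.symm
    exact h1

theorem zetaInv_mul_zeta :
    (toConv zetaInv * toConv zeta.toLinearMap : WithConv (QSym →ₗ[ℂ] ℂ)) = 1 := by
  have h := inv_mul_cancel (toConv zeta : WithConv (QSym →ₐ[ℂ] ℂ))
  exact congrArg (fun f : WithConv (QSym →ₐ[ℂ] ℂ) => toConv f.ofConv.toLinearMap) h

/-- Pullback along a coalgebra map preserves convolution inverses, and inverting a product reverses
the factors. -/
theorem pullback_shuffleHom_zetaInv :
    pullback shuffleHom.toLinearMap (toConv zetaInv) = expOn Odd (-1) * expOn Even (-1) := by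
  refine left_inv_eq_right_inv (a := expOn Even 1 * expOn Odd 1) ?_ ?_
  · rw [← pullback_shuffleHom_zeta, ← pullback_mul, zetaInv_mul_zeta, pullback_one]
  · rw [mul_assoc, ← mul_assoc (expOn Odd 1), expOn_mul, add_neg_cancel, expOn_zero, one_mul,
      expOn_mul, add_neg_cancel, expOn_zero]

/-- After the bar the order is odd, even, even, odd: the two even exponentials meet in the middle
and cancel, and the odd ones combine. -/
theorem pullback_shuffleHom_thetaCharacter :
    pullback shuffleHom.toLinearMap (toConv thetaCharacter) = expOn Odd 2 := by
  have h : (toConv thetaCharacter : WithConv (QSym →ₗ[ℂ] ℂ)) =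
      pullback signMap (toConv zetaInv) * toConv zeta.toLinearMap := by
    rw [thetaCharacter, bar_eq]
    rfl
  have h2 : pullback shuffleHom.toLinearMap (pullback signMap (toConv zetaInv)) =
      pullback signMap (pullback shuffleHom.toLinearMap (toConv zetaInv)) :=
    pullback_signMap_comm _ _
  rw [h, pullback_mul, h2, pullback_shuffleHom_zetaInv, pullback_shuffleHom_zeta,
    pullback_signMap_mul, pullback_signMap_expOn_odd, pullback_signMap_expOn_even, mul_assoc,
    ← mul_assoc (expOn Even (-1)), expOn_mul, neg_add_cancel, expOn_zero, one_mul, expOn_mul,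
    neg_neg, one_add_one_eq_two]

theorem thetaHom_S (α : List ℕ+) : thetaHom (S α) = expOn Odd 2 (M α) := by
  rw [thetaHom_apply, ← shuffleHom_M, ← pullback_shuffleHom_thetaCharacter]
  rfl

/-! ### The theta map on the shuffle functions -/

open Classical in
/-- The eigenvalue of the theta map on `S_α`. -/
def oddWeight (α : List ℕ+) : ℂ := if IsOdd α then 2 ^ α.length else 0

theorem oddWeight_append (α β : List ℕ+) :
    oddWeight (α ++ β) = oddWeight α * oddWeight β := by
  have h : IsOdd (α ++ β) ↔ IsOdd α ∧ IsOdd β := by simp [IsOdd, or_imp, forall_and]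
  unfold oddWeight
  by_cases h1 : IsOdd α <;> by_cases h2 : IsOdd β <;> simp [h, h1, h2, pow_add]

/-- The linear map `M_α ↦ 2^ℓ M_α` if all parts of `α` are odd, `M_α ↦ 0` otherwise. -/
def oddMap : QSym →ₗ[ℂ] QSym := basisM.constr ℂ fun α => oddWeight α • M α

theorem oddMap_M (α : List ℕ+) : oddMap (M α) = oddWeight α • M α := by
  have h := basisM.constr_basis ℂ (fun α : List ℕ+ => oddWeight α • M α) α
  rwa [basisM_apply] at h

/-- `oddMap` as a coalgebra map. -/
def oddHom : QSym →ₗc[ℂ] QSym where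
  __ := oddMap
  counit_comp := by
    refine basisM.ext fun α => ?_
    rw [basisM_apply, LinearMap.comp_apply]
    show Coalgebra.counit (R := ℂ) (oddMap (M α)) = _
    rw [oddMap_M, map_smul]
    have h : Coalgebra.counit (R := ℂ) (M α) = if α = [] then 1 else 0 := counitHom_M α
    rw [h]
    split_ifs with hα
    · subst hα
      simp [oddWeight, IsOdd]
    · simp
  map_comp_comul := by
    refine basisM.ext fun α => ?_
    rw [basisM_apply, LinearMap.comp_apply, LinearMap.comp_apply]
    show TensorProduct.map oddMap oddMap (Coalgebra.comul (R := ℂ) (M α)) =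
      Coalgebra.comul (R := ℂ) (oddMap (M α))
    rw [oddMap_M, map_smul, comul_M, map_sum, Finset.smul_sum]
    refine Finset.sum_congr rfl fun i _ => ?_
    rw [TensorProduct.map_tmul, oddMap_M, oddMap_M, TensorProduct.smul_tmul_smul,
      ← oddWeight_append, List.take_append_drop]

/-- Cofreeness applied to `Θ ∘ shuffleHom = shuffleHom ∘ oddHom`: for odd `β` the coefficients at
`M_b` in degree `b` are `2^ℓ/ℓ!` on the left and `2^ℓ · (1/ℓ!)` on the right; otherwise both vanish.
-/
theorem theta_S (α : List ℕ+) : theta (S α) = oddWeight α • S α := by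
  suffices h : thetaCoalgHom.comp shuffleHom = shuffleHom.comp oddHom by
    have h1 := DFunLike.congr_fun h (M α)
    rw [← shuffleHom_M]
    refine h1.trans ?_
    show shuffleHom (oddMap (M α)) = _
    rw [oddMap_M, map_smul]
  refine coalgHom_ext fun b f => ?_
  suffices h : (coeffM [b]).ofConv ∘ₗ (thetaCoalgHom.comp shuffleHom).toLinearMap =
      (coeffM [b]).ofConv ∘ₗ (shuffleHom.comp oddHom).toLinearMap from LinearMap.congr_fun h f
  refine basisM.ext fun β => ?_
  rw [basisM_apply]
  show coeffM [b] (thetaCoalgHom (shuffleHom (M β))) = coeffM [b] (shuffleHom (oddMap (M β)))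
  have hm : ∀ (c : ℂ) (g : QSym), coeffM [b] (c • g) = c * coeffM [b] g :=
    fun c g => map_smul (coeffM [b]).ofConv c g
  have hmem : shuffleHom (M β) ∈ homogeneous (size β) :=
    cofree_mem_homogeneous _ _ (M_mem_homogeneous β)
  rw [coeffM_singleton_thetaCoalgHom b hmem, oddMap_M, map_smul, hm, shuffleHom_M, thetaHom_S,
    ← shuffleHom_M, shuffleHom, coeffM_singleton_cofree, mul_ite, mul_zero]
  refine if_congr Iff.rfl ?_ rfl
  rw [expOn_M, oddWeight]
  by_cases h : IsOdd β
  · rw [if_pos h, if_pos (show ∀ a ∈ β, Odd (a : ℕ) from h), shuffleWeight_of_isOdd h,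
      mul_one_div]
  · rw [if_neg h, if_neg (show ¬∀ a ∈ β, Odd (a : ℕ) from h), zero_mul]

/-! ### Triangularity, the shuffle basis and the peak algebra -/

/-- Each part of `β` uses up at least one part of `α`, so a nonzero value forces `β` to be shorter
than `α` or equal to it. -/
theorem components_M_of_length_le {t : List ℕ+ → ℂ} {α β : List ℕ+}
    (hl : α.length ≤ β.length) (hne : β ≠ α) : components t β (M α) = 0 := by
  induction β generalizing α with
  | nil => exact absurd (List.length_eq_zero_iff.1 (by simpa using hl)).symm hne
  | cons b β ih =>
    rw [components_cons]
    by_cases h : ∃ γ δ, α = γ ++ δ ∧ size γ = b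
    · obtain ⟨γ, δ, rfl, hb⟩ := h
      rw [conv_component _ _ _ hb]
      rcases γ with _ | ⟨a, γ⟩
      · exact absurd hb b.pos.ne
      · simp only [List.length_append, List.length_cons] at hl
        rw [ih (by omega), mul_zero]
        rintro rfl
        obtain rfl : γ = [] := List.length_eq_zero_iff.1 (by omega)
        apply hne
        rw [size_cons, size_nil, add_zero] at hb
        rw [PNat.coe_injective hb]
        rfl
    · exact conv_component_eq_zero _ _ _ h

theorem components_M_self {t : List ℕ+ → ℂ} (ht : ∀ a, t [a] = 1) (α : List ℕ+) :
    components t α (M α) = 1 := by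
  induction α with
  | nil => rw [components_nil, one_M, if_pos rfl]
  | cons a α ih =>
    have h := conv_component t a (components t α) (α := [a]) (α' := α) (by simp [size_cons, size_nil])
    rw [components_cons]
    simpa [ht, ih] using h

theorem linearIndependent_S : LinearIndependent ℂ S := by
  rw [linearIndependent_iff]
  intro G hG
  by_contra hne
  -- For `α` of maximal length in the support, no other `S_β` of the relation involves `M_α`, while
  -- `S_α` does with coefficient `1`.
  obtain ⟨α, hα, hmax⟩ := Finset.exists_max_image G.support List.length
    (Finsupp.support_nonempty_iff.2 hne)
  have h := congrArg (coeffM α) hG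
  rw [Finsupp.linearCombination_apply, Finsupp.sum] at h
  have hs : coeffM α (∑ β ∈ G.support, G β • S β) = ∑ β ∈ G.support, G β * coeffM α (S β) := by
    refine (map_sum (coeffM α).ofConv _ _).trans (Finset.sum_congr rfl fun β _ => ?_)
    exact map_smul (coeffM α).ofConv _ _
  have h0 : coeffM α 0 = 0 := map_zero (coeffM α).ofConv
  rw [hs, h0, Finset.sum_eq_single α, coeffM_S, components_M_self shuffleWeight_singleton,
    mul_one] at h
  · exact Finsupp.mem_support_iff.1 hα h
  · intro β hβ hβα
    rw [coeffM_S, components_M_of_length_le (hmax β hβ) (Ne.symm hβα), mul_zero]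
  · exact fun h => absurd hα h

theorem S_mem_homogeneous (α : List ℕ+) : S α ∈ homogeneous (size α) := by
  rw [← shuffleHom_M]
  exact cofree_mem_homogeneous _ _ (M_mem_homogeneous α)

/-- Induction on length: `M_α` is `S_α` minus a combination of shorter `M_β` of the same degree. -/
theorem M_mem_span_S (α : List ℕ+) :
    M α ∈ Submodule.span ℂ (S '' {β | size β = size α}) := by
  classical
  induction hl : α.length using Nat.strong_induction_on generalizing α with
  | _ l ih =>
    have h : S α = ∑ β ∈ (finite_size_eq (size α)).toFinset,
        components shuffleWeight β (M α) • M β := by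
      rw [← shuffleHom_M]
      exact cofreeMap_M shuffleWeight α
    rw [← Finset.add_sum_erase _ _ (a := α) (by simp), components_M_self shuffleWeight_singleton,
      one_smul, ← sub_eq_iff_eq_add] at h
    rw [← h]
    refine Submodule.sub_mem _ (Submodule.subset_span ⟨α, rfl, rfl⟩)
      (Submodule.sum_mem _ fun β hβ => ?_)
    rw [Finset.mem_erase, Set.Finite.mem_toFinset] at hβ
    by_cases hlt : β.length < l
    · have := ih _ hlt β rfl
      rw [show size β = size α from hβ.2] at this
      exact Submodule.smul_mem _ _ this
    · rw [components_M_of_length_le (by omega) hβ.1, zero_smul]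
      exact Submodule.zero_mem _

theorem span_S (n : ℕ) : Submodule.span ℂ (S '' {α | size α = n}) = homogeneous n := by
  apply le_antisymm
  · refine Submodule.span_le.2 ?_
    rintro _ ⟨α, rfl, rfl⟩
    exact S_mem_homogeneous α
  · refine Submodule.span_le.2 ?_
    rintro _ ⟨α, rfl, rfl⟩
    exact M_mem_span_S α

theorem span_range_S : Submodule.span ℂ (Set.range S) = ⊤ := by
  refine top_unique (span_M.trans (Submodule.span_le.2 ?_))
  rintro _ ⟨α, rfl⟩
  exact Submodule.span_mono (Set.image_subset_range _ _) (M_mem_span_S α)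

theorem peakAlgebra_theta :
    peakAlgebra theta = Submodule.span ℂ (S '' {α | IsOdd α}) := by
  have h : peakAlgebra theta =
      Submodule.span ℂ ((theta : QSym →ₗ[ℂ] QSym) '' Set.range S) := by
    rw [← Submodule.map_span, span_range_S, Submodule.map_top, peakAlgebra]
  rw [h]
  apply le_antisymm <;> refine Submodule.span_le.2 ?_
  · rintro _ ⟨_, ⟨α, rfl⟩, rfl⟩
    show theta (S α) ∈ Submodule.span ℂ (S '' {α | IsOdd α})
    rw [theta_S, oddWeight]
    split_ifs with hα
    · exact Submodule.smul_mem _ _ (Submodule.subset_span ⟨α, hα, rfl⟩)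
    · rw [zero_smul]
      exact Submodule.zero_mem _
  · rintro _ ⟨α, hα, rfl⟩
    have h1 : theta (S α) = (2 : ℂ) ^ α.length • S α := by
      rw [theta_S, oddWeight, if_pos (show IsOdd α from hα)]
    -- The eigenvalue `2^ℓ` is invertible, so `S_α` itself lies in the image.
    have h2 : S α = ((2 : ℂ) ^ α.length)⁻¹ • theta (S α) := by
      rw [h1, smul_smul, inv_mul_cancel₀ (pow_ne_zero _ two_ne_zero), one_smul]
    rw [h2]
    exact Submodule.smul_mem _ _ (Submodule.subset_span ⟨_, ⟨α, rfl⟩, rfl⟩)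

end QSym

end

theorem mainTheorem1 :
    (LinearIndependent ℂ QSym.S ∧
      ∀ n : ℕ, Submodule.span ℂ (QSym.S '' {α | QSym.size α = n}) = QSym.homogeneous n) ∧
    ∃ Θ : QSym →ₐc[ℂ] QSym,
      QSym.IsThetaMap Θ ∧ (∀ Ψ : QSym →ₐc[ℂ] QSym, QSym.IsThetaMap Ψ → Ψ = Θ) ∧
      (∀ α : List ℕ+, QSym.IsOdd α → Θ (QSym.S α) = (2 : ℂ) ^ α.length • QSym.S α) ∧
      (∀ α : List ℕ+, ¬ QSym.IsOdd α → Θ (QSym.S α) = 0) ∧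
      QSym.peakAlgebra Θ = Submodule.span ℂ (QSym.S '' {α | QSym.IsOdd α}) := by

  refine ⟨⟨QSym.linearIndependent_S, QSym.span_S⟩, QSym.theta, QSym.isThetaMap_theta,
    fun Ψ hΨ => hΨ.eq_theta, fun α hα => ?_, fun α hα => ?_, QSym.peakAlgebra_theta⟩
  · rw [QSym.theta_S, QSym.oddWeight, if_pos hα]
  · rw [QSym.theta_S, QSym.oddWeight, if_neg hα, zero_smul]
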